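/- Fix $\theta\in[0,\pi/2]$ and put $|\psi_a\rangle=\cos\frac\theta2|0\rangle+(-1)^a\sin\frac\theta2|1\rangle$ $(a\in\{0,1\})$, $p_{\min}=\frac12(1-\sin\theta)$, $p_{\max}=\frac12(1+\sin\theta)$. **Protocol VBCT1.** Alice and Bob have agents $A_i,B_i$ $(i=1,2,3)$ at three separated sites. Bob's agents agree on a secret random number $n\ge 0$ of law $\mu$ (e.g. Poisson with large mean); $n$ is the number of rounds before the coin round. In every round $A_1$ sends $B_1$ a qubit in the state $|\psi_a\rangle$, $a$ a fresh uniform bit, and at spacelike separation $A_2$ declares $a$ to $B_2$, who relays it to $B_1$. At spacelike separation from the communications of the coin round, $B_3$ announces that this is the coin round; the transmission ends with it. $B_1$, before the declaration of the coin round can reach him, measures the coin qubit in the basis $|\pm\rangle=\frac1{\sqrt2}(|0\rangle\pm|1\rangle)$ with result $b'$ ($b'=0$ for $|+\rangle$) and announces $b=b'\oplus w$, where $w\in\{0,1\}$ is Bob's wish (input). $B_1$ tests each of the $n$ earlier qubits against its declared identity and aborts if a test fails or a declaration is missing. Otherwise the outcome is $c=a\oplus b$, $a$ being the declared identity of the coin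 qubit. Let $P_{\rm id}(c|w)=p_{\max}$ if $c=w$ and $p_{\min}$ if $c\neq w$. A dishonest party may use any strategy allowed by quantum theory and by the spacelike separations above; Alice's qubits and declarations may be arbitrarily correlated and entangled with each other and with a quantum memory. Then the following hold. 1. *Honest runs.* The measurement in $\{|+\rangle,|-\rangle\}$ maximizes the probability of correctly guessing which of the equiprobable states $|\psi_0\rangle,|\psi_1\rangle$ is given; the maximum is $p_{\max}$. For every $\mu$, if both parties are honest the outcome is $c$ with probability $P_{\rm id}(c|w)$; the protocol never aborts. 2. *Biases.* The probabilities of outcome $0$ that Bob can realise against an honest Alice with strategies that never lead to an abort are exactly those in $[p_{\min},p_{\max}]$, and $p_{\min}+p_{\max}=1$. As $\theta$ varies over $[0,\pi/2]$, the ranges $[x,y]$ with $x<y$ that occur are exactly those with $0\le x$ and $x+y=1$. 3. *Perfect security against Bob.* For any strategy of Bob against an honest Alice there is $p\in[p_{\min},p_{\max}]$ such that $\Pr(\text{outcome }0)\le p$ and $\Pr(\text{outcome }1)\le 1-p$. 4. *An honest Alice learns nothing beyond $c$.* Given $w$, the bits $a_0,\dots,a_n$ and $b$ have probability $P_{\rm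 id}(c|w)\,2^{-(n+1)}$, $c=a_n\oplus b$; so they can be simulated from $c$ alone, and for every prior of $w$ the posterior given all of them is the posterior given $c$. 5. *Alice cannot shift Bob's measurement statistics undetected.* For an arbitrary strategy of Alice and $0<\delta\le1$ call a round altered if the probability $\langle +|\rho|+\rangle$, $\rho$ being the state of the qubit $B_1$ holds conditional on Alice's classical records and declarations up to and including that round and on the earlier qubits passing their tests, differs by at least $\delta$ from the value the protocol dictates for the declared state ($p_{\max}$ for $\psi_0$, $p_{\min}$ for $\psi_1$). Then (a) for all $n,k$ the probability that at least $k$ of the first $n$ rounds are altered and all $n$ qubits nevertheless pass their tests is at most $(1-\delta^2)^k$; (b) let $\gamma\ge0$ and $n\in\mathbb N$, and suppose that, averaged over Bob's random choice of the coin round, the conditional probability that the coin round is altered, given that at least $\gamma n$ tested rounds are altered and all tests are passed, is at most $\gamma$. Then the probability that the coin round and at least $\gamma n$ tested rounds are altered and that Alice is not detected is at most $\gamma(1-\delta^2)^{\gamma n}$. For fixed $\gamma>0$ this tends to $0$ as $n\to\infty$; (c) without any assumption on the fraction of altered rounds, the probability that the coin round is altered and Alice is not detected is at most $\delta^{-2}\sup_n\mu(\{n\})$;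 for Poisson $\mu$ it tends to $0$, uniformly over all strategies of Alice, as the mean tends to infinity. 6. *Asymptotic security against Alice.* Let $\mu$ be Poisson with mean $r$. There are functions $\varepsilon(r),\delta(r),\zeta(r)\to0$ $(r\to\infty)$ such that, for every $r$ and every strategy of Alice against an honest Bob: $\Pr(\text{outcome }c)\le P_{\rm id}(c|w)+\varepsilon(r)$ for all $w,c$; and, for every prior of $w$ and every final measurement of Alice's memory (which may depend on all she has heard), the probability that Bob accepts and that all the data she holds carry more than $\delta(r)$ bits of Shannon information on $w$ beyond what $c$ implies under $P_{\rm id}$, or give a posterior that differs by more than $\delta(r)$ from the one implied by $c$, is less than $\zeta(r)$. If $B_1$ carries out the tests before he announces $b$ (aborting without announcing $b$ if one fails), the same bound $\zeta(r)$ holds for the sum of this probability and the probability that he aborts and that what she holds carries more than $\delta(r)$ bits of information on $w$, or gives a posterior that differs by more than $\delta(r)$ from the prior. -/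

import Mathlib

open Set Filter Topology MeasureTheory ProbabilityTheory
open scoped NNReal

universe u

noncomputable section

namespace VBCT1

/-! ### Qubits

Computational basis states of a qubit are indexed by `Bool` (`false` is `0`, `true` is `1`).
A vector of `ℂ² ⊗ H` is the pair of its two `H`-valued amplitudes, with the `ℓ²` norm. -/

/-- The state space of one qubit. -/
abbrev Qubit := EuclideanSpace ℂ Bool

/-- The Hilbert space `ℂ² ⊗ H`. -/
abbrev WithQubit (H : Type u) := PiLp 2 (fun _ : Bool => H)

/-- The two agreed states `cos (θ/2) |0⟩ ± sin (θ/2) |1⟩`, with the sign `+` for `a = 0`. -/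
def psi (θ : ℝ) (a : Bool) : Qubit :=
  WithLp.toLp 2 (fun q =>
    if q then (if a then -((Real.sin (θ / 2) : ℝ) : ℂ) else ((Real.sin (θ / 2) : ℝ) : ℂ))
    else ((Real.cos (θ / 2) : ℝ) : ℂ))

/-- The measurement basis: `|+⟩` for outcome `0` and `|-⟩` for outcome `1`. -/
def pm (b : Bool) : Qubit :=
  WithLp.toLp 2 (fun q =>
    if q && b then -(((√2)⁻¹ : ℝ) : ℂ) else (((√2)⁻¹ : ℝ) : ℂ))

/-- The smaller bias. -/
def pMin (θ : ℝ) : ℝ := (1 - Real.sin θ) / 2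

/-- The larger bias. -/
def pMax (θ : ℝ) : ℝ := (1 + Real.sin θ) / 2

section Tensor

variable {H : Type u} [NormedAddCommGroup H] [InnerProductSpace ℂ H]

/-- The product vector `φ ⊗ v`. -/
def tensor (φ : Qubit) (v : H) : WithQubit H := WithLp.toLp 2 (fun q => φ q • v)

/-- The partial inner product `(⟨φ| ⊗ 1) Φ`; its squared norm is the probability of finding the
qubit in the state `φ`, and it is the unnormalised state of the rest after that. -/
def contract (φ : Qubit) (Φ : WithQubit H) : H := ∑ q, (starRingEnd ℂ) (φ q) • Φ q

end Tensor

/-! ### The ideal coin -/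

/-- Probability of outcome `c` when Bob's wish is `w`: wish `0` gives outcome `0` probability
`pMax`, wish `1` gives outcome `0` probability `pMin`. -/
def ideal (θ : ℝ) (w c : Bool) : ℝ := if c = w then pMax θ else pMin θ

/-- Bayes' rule for a bit with prior `π` and likelihoods `ℓ`. -/
def posterior (π ℓ : Bool → ℝ) (w : Bool) : ℝ := π w * ℓ w / ∑ w', π w' * ℓ w'

/-- Shannon entropy, in bits, of a bit with distribution `π`. -/
def bits (π : Bool → ℝ) : ℝ := Real.binEntropy (π false) / Real.log 2

/-- The distribution `π'` carries more than `δ` bits of information beyond `π`, or differs from it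
by more than `δ`. -/
def Informs (δ : ℝ) (π π' : Bool → ℝ) : Prop :=
  δ < bits π - bits π' ∨ ∃ w, δ < |π' w - π w|

/-! ### A possibly dishonest Alice

Alice's agents share a quantum memory with Hilbert space `H`. In every round they apply an
instrument, given by an isometry followed by reading off a classical register with values in the
finite set `X`: it produces a classical record `x : X`, the qubit handed to `B₁`, and the new
memory. The record determines the identity that `A₂` declares to `B₂` for this qubit (`none` means
that no valid declaration, or no qubit, is sent, upon which Bob aborts). The rounds up to the coin
round are performed without any knowledge of which round this is: `B₃` announces it at a point
spacelike separated from the communications of that round. The records of all rounds are kept. -/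

/-- A strategy of Alice. -/
structure AliceStrategy (H : Type u) [NormedAddCommGroup H] [InnerProductSpace ℂ H] (X : Type)
    [Fintype X] where
  /-- the initial state of the memory -/
  init : H
  norm_init : ‖init‖ = 1
  /-- round `i`: the memory is mapped to (record, qubit, memory) -/
  step : ℕ → H →ₗᵢ[ℂ] PiLp 2 (fun _ : X × Bool => H)
  /-- the declared identity of the qubit -/
  ann : X → Option Bool

namespace AliceStrategy

variable {H : Type u} [NormedAddCommGroup H] [InnerProductSpace ℂ H] {X : Type} [Fintype X]
variable (S : AliceStrategy H X) (θ : ℝ)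

/-- Unnormalised state of (qubit, memory) after round `i` gave the record `x`. -/
def emit (i : ℕ) (v : H) (x : X) : WithQubit H := WithLp.toLp 2 (fun q => S.step i v (x, q))

/-- Unnormalised state of the memory when the first `n` rounds gave the records `x` and Bob has
tested each of the `n` qubits and found it in the declared state. Its squared norm is the
probability of these records and test results. -/
def passed : (n : ℕ) → (Fin n → X) → H
  | 0, _ => S.init
  | n + 1, x =>
    match S.ann (x (Fin.last n)) with
    | none => 0
    | some a => contract (psi θ a) (S.emit n (passed n (Fin.init x)) (x (Fin.last n)))

/-- Unnormalised state of (qubit number `n`, memory) when the rounds `0, …, n` gave the records `x`,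
with valid declarations, and the qubits `0, …, n - 1` have passed Bob's test, but qubit `n` has not
been touched. -/
def coin (n : ℕ) (x : Fin (n + 1) → X) : WithQubit H :=
  match S.ann (x (Fin.last n)) with
  | none => 0
  | some _ => S.emit n (S.passed θ n (Fin.init x)) (x (Fin.last n))

/-- Component along `q` of the unnormalised state after `n` rounds with records `x`, without any
test. -/
def raw : (n : ℕ) → (Fin n → X) → (Fin n → Bool) → H
  | 0, _, _ => S.init
  | n + 1, x, q => S.step n (raw n (Fin.init x) (Fin.init q)) (x (Fin.last n), q (Fin.last n))

/-! #### Outcomes against an honest Bob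

Rounds are numbered from `0`. Bob's secret choice is the number `n` of rounds that precede the coin
round; it has the law `μ`. Bob stores the qubits, measures qubit `n` in the basis `|±⟩` with result
`b'`, reveals `n` and `b = b' ⊕ w`, where `w` is his wish, tests the other `n` qubits against their
declared identities and aborts on any failure; otherwise the outcome is `c = a ⊕ b` where `a` is
the declared identity of qubit `n`. -/

/-- Probability of the outcome `c` given that `n` rounds precede the coin round. -/
def outcomeAt (w c : Bool) (n : ℕ) : ℝ :=
  ∑ x : Fin (n + 1) → X, ∑ b' : Bool,
    if (S.ann (x (Fin.last n))).map (fun a => xor a (xor b' w)) = some c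
    then ‖contract (pm b') (S.coin θ n x)‖ ^ 2 else 0

/-- Probability that the protocol is completed with outcome `c`. -/
def outcomeProb (μ : Measure ℕ) (w c : Bool) : ℝ := ∫ n, S.outcomeAt θ w c n ∂μ

/-! #### Shifting the statistics of Bob's measurement -/

/-- Probability of the result `|+⟩` on qubit `n`, given the records and that the earlier qubits
pass their tests: this is `⟨+|ρ|+⟩` for the state `ρ` in which Bob then holds qubit `n`. -/
def plusProb (n : ℕ) (x : Fin (n + 1) → X) : ℝ :=
  ‖contract (pm false) (S.coin θ n x)‖ ^ 2 / ‖S.coin θ n x‖ ^ 2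

/-- The probability of the result `|+⟩` on qubit `n` differs by at least `δ` from the value that
the protocol dictates for the declared state. -/
def Altered (δ : ℝ) (n : ℕ) (x : Fin (n + 1) → X) : Prop :=
  ∃ a, S.ann (x (Fin.last n)) = some a ∧
    δ ≤ |S.plusProb θ n x - if a then pMin θ else pMax θ|

open Classical in
/-- The number of altered rounds among the first `n`. -/
def alteredCount (δ : ℝ) (n : ℕ) (x : Fin n → X) : ℕ :=
  (Finset.univ.filter (fun i : Fin n =>
    S.Altered θ δ i (fun j : Fin (i + 1) => x (Fin.castLE i.isLt j)))).card

open Classical in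
/-- Probability that at least `k` of the first `n` rounds are altered and yet all `n` qubits pass
Bob's test. -/
def undetectedAt (δ k : ℝ) (n : ℕ) : ℝ :=
  ∑ x : Fin n → X, if k ≤ S.alteredCount θ δ n x then ‖S.passed θ n x‖ ^ 2 else 0

open Classical in
/-- Given that `n` rounds precede the coin round: probability that the coin round is altered, at
least `k` of the tested rounds are altered, and all tests are passed. -/
def cheatAt (δ k : ℝ) (n : ℕ) : ℝ :=
  ∑ x : Fin (n + 1) → X,
    if S.Altered θ δ n x ∧ k ≤ S.alteredCount θ δ n (Fin.init x)
    then ‖S.coin θ n x‖ ^ 2 else 0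

/-- Probability that Alice alters the coin round and at least `k` tested rounds by at least `δ`,
and escapes detection. -/
def cheatProb (μ : Measure ℕ) (δ k : ℝ) : ℝ := ∫ n, S.cheatAt θ δ k n ∂μ

/-- Probability that the coin round is altered, conditional on at least `k` tested rounds being
altered and all tests being passed, averaged over the number of rounds before the coin round. -/
def coinAlteredProb (μ : Measure ℕ) (δ k : ℝ) : ℝ :=
  ∫ n, S.cheatAt θ δ k n / S.undetectedAt θ δ k n ∂μ

end AliceStrategy

/-! #### Alice's information on Bob's wish

At the end Alice measures her memory. The measurement may depend on the number `n` of rounds before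
the coin round, on her records, and on what she hears from Bob: `some b` if he announces the bit `b`
and accepts, `none` if he aborts. -/

/-- A final measurement with results in `M`. -/
structure Readout (H : Type u) [NormedAddCommGroup H] [InnerProductSpace ℂ H]
    (X M : Type) [Fintype M] where
  /-- the operators of the measurement -/
  eff : (n : ℕ) → (Fin (n + 1) → X) → Option Bool → M → H →L[ℂ] H
  positive : ∀ n x y m, (eff n x y m).IsPositive
  sum_eq : ∀ n x y, ∑ m, eff n x y m = ContinuousLinearMap.id ℂ H

namespace AliceStrategy

variable {H : Type u} [NormedAddCommGroup H] [InnerProductSpace ℂ H] {X : Type} [Fintype X]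
variable {M : Type} [Fintype M]
variable (S : AliceStrategy H X) (θ : ℝ) (R : Readout H X M)

/-- Probability, given `n` and Bob's wish `w`, of the records `x`, the announcement `b`, passing
all tests and the final measurement result `m`. -/
def acceptLik (n : ℕ) (x : Fin (n + 1) → X) (b : Bool) (m : M) (w : Bool) : ℝ :=
  (R.eff n x (some b) m).reApplyInnerSelf (contract (pm (xor b w)) (S.coin θ n x))

/-- Probability, given `n`, of the records `x`, of Bob aborting before he has announced a bit, and
of the final measurement result `m`: the total weight minus the weight of passing all tests. Bob's
wish has not been used by then. -/
def abortLik (n : ℕ) (x : Fin (n + 1) → X) (m : M) : ℝ :=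
  (∑ q : Fin (n + 1) → Bool, (R.eff n x none m).reApplyInnerSelf (S.raw (n + 1) x q))
    - ∑ b' : Bool, (R.eff n x none m).reApplyInnerSelf (contract (pm b') (S.coin θ n x))

open Classical in
/-- For the prior `π` of Bob's wish: probability that Bob accepts and that what Alice holds carries
more than `δ` bits of information on the wish beyond what the outcome `c = a ⊕ b` implies. -/
def acceptedLeak (μ : Measure ℕ) (π : Bool → ℝ) (δ : ℝ) : ℝ :=
  ∫ n, (∑ x : Fin (n + 1) → X, ∑ b : Bool, ∑ m : M,
    if ∃ a, S.ann (x (Fin.last n)) = some a ∧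
        Informs δ (posterior π (fun w => ideal θ w (xor a b)))
          (posterior π (S.acceptLik θ R n x b m))
    then ∑ w : Bool, π w * S.acceptLik θ R n x b m w else 0) ∂μ

open Classical in
/-- For the prior `π`: probability that Bob aborts before he has announced a bit and that what Alice
holds carries more than `δ` bits of information on the wish. -/
def abortedLeak (μ : Measure ℕ) (π : Bool → ℝ) (δ : ℝ) : ℝ :=
  ∫ n, (∑ x : Fin (n + 1) → X, ∑ m : M,
    if Informs δ π (posterior π (fun _ => S.abortLik θ R n x m))
    then ∑ w : Bool, π w * S.abortLik θ R n x m else 0) ∂μ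

end AliceStrategy

/-! ### Honest Alice -/

/-- Amplitude of an honest Alice for the record `a` and the qubit basis state `q`. -/
def honestAmp (θ : ℝ) (p : Bool × Bool) : ℂ := (((√2)⁻¹ : ℝ) : ℂ) * psi θ p.1 p.2

theorem honestAmp_norm (θ : ℝ) (v : ℂ) :
    ‖(WithLp.toLp 2 (fun p : Bool × Bool => honestAmp θ p * v) :
      PiLp 2 (fun _ : Bool × Bool => ℂ))‖ = ‖v‖ := by
  have h2 : (√2)⁻¹ ^ 2 = (1 / 2 : ℝ) := by
    rw [inv_pow, Real.sq_sqrt (by norm_num)]; norm_num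
  have hsc := Real.sin_sq_add_cos_sq (θ / 2)
  have key : ‖(WithLp.toLp 2 (fun p : Bool × Bool => honestAmp θ p * v) :
      PiLp 2 (fun _ : Bool × Bool => ℂ))‖ ^ 2 = ‖v‖ ^ 2 := by
    rw [PiLp.norm_sq_eq_of_L2]
    simp only [Fintype.sum_prod_type, Fintype.sum_bool, honestAmp, psi, norm_mul, mul_pow,
      Complex.norm_real, Real.norm_eq_abs, sq_abs, if_true, norm_neg, h2, Bool.false_eq_true,
      if_false]
    linear_combination ‖v‖ ^ 2 * hsc
  exact (sq_eq_sq₀ (norm_nonneg _) (norm_nonneg _)).1 key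

/-- Honest Alice: in each round she draws a uniformly random bit `a`, sends the state `psi θ a` and
declares `a`. She needs no memory beyond her records. -/
def honestAlice (θ : ℝ) : AliceStrategy ℂ Bool where
  init := 1
  norm_init := norm_one
  step := fun _ =>
    { toFun := fun v => WithLp.toLp 2 (fun p : Bool × Bool => honestAmp θ p * v)
      map_add' := by intro v w; ext p; simp [mul_add]
      map_smul' := by intro c v; ext p; simp [mul_left_comm]
      norm_map' := honestAmp_norm θ }
  ann := some

/-- Probability, given `n` and Bob's wish `w`, that an honest Alice ends up with the bits
`x 0, …, x n` and Bob's announcement `b`. -/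
def honestLik (θ : ℝ) (n : ℕ) (x : Fin (n + 1) → Bool) (b w : Bool) : ℝ :=
  ‖contract (pm (xor b w)) ((honestAlice θ).coin θ n x)‖ ^ 2

/-! ### A possibly dishonest Bob, against an honest Alice

Bob's agents share a quantum memory with Hilbert space `L`. Before the communications of round `i`
they decide, by a quantum operation, whether `B₃` announces round `i` as the coin round
(`B₃`'s announcement is spacelike separated from these communications). If not, they receive the
qubit and then its identity. If so, `B₁` has to announce `b` from the qubit and the memory alone,
before the identity can reach him. All operations may lose norm: the missing weight is the
probability that Bob breaks off, whereupon the protocol is aborted. -/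

/-- A strategy of Bob. -/
structure BobStrategy (L : Type u) [NormedAddCommGroup L] [InnerProductSpace ℂ L] where
  /-- the initial state of the memory -/
  init : L
  norm_init : ‖init‖ = 1
  /-- before round `i`: component `true` if round `i` is announced as the coin round -/
  choose : ℕ → L →L[ℂ] PiLp 2 (fun _ : Bool => L)
  norm_choose_le : ∀ i, ‖choose i‖ ≤ 1
  /-- after an ordinary round `i` in which the qubit was declared to be `a` -/
  absorb : ℕ → Bool → WithQubit L →L[ℂ] L
  norm_absorb_le : ∀ i a, ‖absorb i a‖ ≤ 1
  /-- the measurement in the coin round `i` that determines the announced bit `b` -/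
  guess : ℕ → Bool → WithQubit L →L[ℂ] WithQubit L
  guess_pos : ∀ i b, (guess i b).IsPositive
  guess_le : ∀ i, (ContinuousLinearMap.id ℂ (WithQubit L) - ∑ b, guess i b).IsPositive

namespace BobStrategy

variable {L : Type u} [NormedAddCommGroup L] [InnerProductSpace ℂ L]
variable (B : BobStrategy L) (θ : ℝ)

/-- Unnormalised state of the memory after `n` ordinary rounds in which Alice sent the states with
labels `a`. -/
def state : (n : ℕ) → (Fin n → Bool) → L
  | 0, _ => B.init
  | n + 1, a =>
    B.absorb n (a (Fin.last n))
      (tensor (psi θ (a (Fin.last n))) (B.choose n (state n (Fin.init a)) false))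

/-- Probability that the coin round is preceded by `n` rounds and the outcome is `c`. Alice's bits
are uniform, and the outcome is `c` if Bob announces `a ⊕ c`. -/
def outcomeAt (c : Bool) (n : ℕ) : ℝ :=
  ∑ a : Fin (n + 1) → Bool, (1 / 2) ^ (n + 1) *
    (B.guess n (xor (a (Fin.last n)) c)).reApplyInnerSelf
      (tensor (psi θ (a (Fin.last n))) (B.choose n (B.state θ n (Fin.init a)) true))

/-- Probability that the protocol is completed with outcome `c`. -/
def outcomeProb (c : Bool) : ℝ := ∑' n, B.outcomeAt θ c n

end BobStrategy

/-- The probabilities of outcome `0` that Bob can realise, by any strategy whatever that is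
certain not to lead to an abort. -/
def achievableBiases (θ : ℝ) : Set ℝ :=
  {p | ∃ (L : Type) (_ : NormedAddCommGroup L) (_ : InnerProductSpace ℂ L) (_ : CompleteSpace L)
      (B : BobStrategy L), B.outcomeProb θ false = p ∧ B.outcomeProb θ true = 1 - p}

end VBCT1

end

/-!
Throughout, `S.passed`, `S.coin` and `S.failed` are unnormalised vectors whose squared norms are
probabilities.

*Bob.* The two agreed states are `c e₀ ± s e₁`, with `e₀`, `e₁` orthogonal and of equal norm, also
in the presence of Bob's memory. For a two-outcome measurement the cross term is a quarter of the
difference of the values at `e₀ ± e₁` of a quadratic form that lies between `0` and the squared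
norm, which gives Helstrom's bound (`helstrom`, `helstrom_tensor`). The probabilities that Bob
picks the various rounds as the coin round add up to at most `1`
(`BobStrategy.tsum_coinWeight_le`), so both outcomes have probability at most `pMax`; every bias in
the range is realised by inverting the result of the measurement in `|±⟩` at random (`mixedBob`).

*Alice.* In the basis of the declared state and its orthogonal complement (`psi`, `perp`), the state
that Bob holds splits into a component `u` that passes the test and a component `v` that fails it,
and `⟨±|` acts as `A u + B v` with real `A`, `B`, where `A²` is the ideal probability
(`contract_pm`, `overlap_sq`). Two facts follow.

* A shift of the statistics by `δ` forces `‖v‖² ≥ δ² (‖u‖² + ‖v‖²)` (`sq_mul_le_of_le_abs_sub`), so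
  an altered round is detected with probability at least `δ²`, and a supermartingale argument bounds
  the probability of `k` undetected alterations (`sum_pow_sub_alteredCount_le`).
* The events "qubit `n` is the first to fail" are disjoint, so the weights `‖v‖²` of all rounds
  add up to at most `1` (`sum_failWeight_le`). Since Alice does not know the coin round, the mean
  of `‖v‖²` in the coin round is at most the largest weight `C` of the law of `n`
  (`integral_le_of_sum_range_le`), which for a Poisson law tends to `0` by Stirling's formula
  (`poissonMeasure_real_le_poissonPeak`).

For every positive operator `T`, the forms of `T` at `A u + B v` and at `A u` differ by at most
`t ⟨u, T u⟩ + (1 + 1/t) ⟨v, T v⟩` (`abs_reApplyInnerSelf_add_sub_le`). Summing over the results of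
Alice's final measurement and choosing `t = √C`, the joint law of all she holds is within
`C + 2 √C` of one in which the likelihoods of Bob's wish are the ideal ones, for each announcement
`b`. By Markov's inequality the posterior is then close to the ideal one except with small
probability (`mul_sum_le_of_le_abs_posterior_sub`), and uniform continuity of the binary entropy
turns this into a bound on information (`Informs.exists_le_abs_sub`). If Bob aborts before his
announcement, the likelihoods do not depend on his wish at all (`abortedLeak_eq_zero`).
-/

namespace VBCT1

/-! ### Positive quadratic forms -/

section Forms

variable {H : Type u} [NormedAddCommGroup H] [InnerProductSpace ℂ H]

theorem reApplyInnerSelf_nonneg {T : H →L[ℂ] H} (hT : T.IsPositive) (v : H) :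
    0 ≤ T.reApplyInnerSelf v := hT.re_inner_nonneg_left v

theorem reApplyInnerSelf_id (v : H) :
    (ContinuousLinearMap.id ℂ H).reApplyInnerSelf v = ‖v‖ ^ 2 := by
  rw [ContinuousLinearMap.reApplyInnerSelf_apply]
  exact inner_self_eq_norm_sq v

theorem reApplyInnerSelf_sum {ι : Type*} (s : Finset ι) (T : ι → H →L[ℂ] H) (v : H) :
    (∑ i ∈ s, T i).reApplyInnerSelf v = ∑ i ∈ s, (T i).reApplyInnerSelf v := by
  simp [ContinuousLinearMap.reApplyInnerSelf_apply, sum_inner]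

theorem reApplyInnerSelf_sub_op (T T' : H →L[ℂ] H) (v : H) :
    (T - T').reApplyInnerSelf v = T.reApplyInnerSelf v - T'.reApplyInnerSelf v := by
  simp [ContinuousLinearMap.reApplyInnerSelf_apply, inner_sub_left]

theorem reApplyInnerSelf_le_norm_sq {T : H →L[ℂ] H}
    (hT : (ContinuousLinearMap.id ℂ H - T).IsPositive) (v : H) :
    T.reApplyInnerSelf v ≤ ‖v‖ ^ 2 := by
  have h := reApplyInnerSelf_nonneg hT v
  rw [reApplyInnerSelf_sub_op, reApplyInnerSelf_id] at h
  linarith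

theorem reApplyInnerSelf_add {T : H →L[ℂ] H} (hT : T.IsPositive) (A B : ℝ) (u v : H) :
    T.reApplyInnerSelf ((A : ℂ) • u + (B : ℂ) • v)
      = A ^ 2 * T.reApplyInnerSelf u + B ^ 2 * T.reApplyInnerSelf v
        + 2 * (A * B) * RCLike.re (inner ℂ (T u) v) := by
  have h : RCLike.re (inner ℂ (T v) u) = RCLike.re (inner ℂ (T u) v) := by
    rw [hT.inner_left_eq_inner_right, ← inner_re_symm]
  change (inner ℂ (T v) u).re = (inner ℂ (T u) v).re at h
  change _ = _ + 2 * (A * B) * (inner ℂ (T u) v).re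
  simp only [ContinuousLinearMap.reApplyInnerSelf_apply, map_add, map_smul, inner_add_left,
    inner_add_right, inner_smul_left, inner_smul_right, Complex.conj_ofReal, map_add,
    RCLike.re_eq_complex_re, Complex.re_ofReal_mul, Complex.add_re, h]
  ring

theorem norm_sq_add_smul (A B : ℝ) (u v : H) :
    ‖(A : ℂ) • u + (B : ℂ) • v‖ ^ 2
      = A ^ 2 * ‖u‖ ^ 2 + B ^ 2 * ‖v‖ ^ 2 + 2 * (A * B) * RCLike.re (inner ℂ u v) := by
  have := reApplyInnerSelf_add (ContinuousLinearMap.isPositive_id (𝕜 := ℂ) (E := H)) A B u v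
  rwa [reApplyInnerSelf_id, reApplyInnerSelf_id, reApplyInnerSelf_id,
    ContinuousLinearMap.id_apply] at this

theorem abs_two_mul_re_inner_le {T : H →L[ℂ] H} (hT : T.IsPositive) {t : ℝ} (ht : 0 < t)
    (u v : H) :
    |2 * RCLike.re (inner ℂ (T u) v)| ≤ t * T.reApplyInnerSelf u + t⁻¹ * T.reApplyInnerSelf v := by
  have h1 := reApplyInnerSelf_nonneg hT (((t : ℝ) : ℂ) • u + ((1 : ℝ) : ℂ) • v)
  have h2 := reApplyInnerSelf_nonneg hT (((t : ℝ) : ℂ) • u + ((-1 : ℝ) : ℂ) • v)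
  rw [reApplyInnerSelf_add hT] at h1 h2
  have e : t * T.reApplyInnerSelf u + t⁻¹ * T.reApplyInnerSelf v
      = t⁻¹ * (t ^ 2 * T.reApplyInnerSelf u + T.reApplyInnerSelf v) := by field_simp
  have e' (y : ℝ) : y = t⁻¹ * (t * y) := by field_simp
  rw [e, abs_le]
  constructor
  · rw [e' (2 * _), ← mul_neg]
    exact mul_le_mul_of_nonneg_left (by linarith) (inv_nonneg.2 ht.le)
  · rw [e' (2 * _)]
    exact mul_le_mul_of_nonneg_left (by linarith) (inv_nonneg.2 ht.le)

/-- A small component `v` perturbs a positive quadratic form little; the free parameter `t` weighs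
the two sides of the Cauchy-Schwarz bound on the cross term. -/
theorem abs_reApplyInnerSelf_add_sub_le {T : H →L[ℂ] H} (hT : T.IsPositive) {A B t : ℝ}
    (hAB : A ^ 2 + B ^ 2 = 1) (ht : 0 < t) (u v : H) :
    |T.reApplyInnerSelf ((A : ℂ) • u + (B : ℂ) • v) - A ^ 2 * T.reApplyInnerSelf u|
      ≤ t * T.reApplyInnerSelf u + (1 + t⁻¹) * T.reApplyInnerSelf v := by
  have hu := reApplyInnerSelf_nonneg hT u
  have hv := reApplyInnerSelf_nonneg hT v
  have hc := abs_two_mul_re_inner_le hT ht u v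
  have hABle : |A * B| ≤ 1 := by
    rw [abs_le]; constructor <;> nlinarith [sq_nonneg (A + B), sq_nonneg (A - B)]
  have e : T.reApplyInnerSelf ((A : ℂ) • u + (B : ℂ) • v) - A ^ 2 * T.reApplyInnerSelf u
      = B ^ 2 * T.reApplyInnerSelf v + (A * B) * (2 * RCLike.re (inner ℂ (T u) v)) := by
    rw [reApplyInnerSelf_add hT]; ring
  rw [e]
  have h1 : |(A * B) * (2 * RCLike.re (inner ℂ (T u) v))|
      ≤ t * T.reApplyInnerSelf u + t⁻¹ * T.reApplyInnerSelf v := by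
    rw [abs_mul]
    exact (mul_le_of_le_one_left (abs_nonneg _) hABle).trans hc
  have h2 : |B ^ 2 * T.reApplyInnerSelf v| ≤ T.reApplyInnerSelf v := by
    rw [abs_of_nonneg (by positivity)]
    exact mul_le_of_le_one_left hv (by nlinarith)
  refine (abs_add_le _ _).trans ?_
  linarith

/-- If the result `+` has probability `‖A u + B v‖² / N` where `N = ‖u‖² + ‖v‖²`, its distance from
`A²` is at most the square root of the weight `‖v‖² / N`: this is the bound of the trace distance
by the fidelity with a pure state. -/
theorem sq_mul_le_of_le_abs_sub {A B δ : ℝ} (hAB : A ^ 2 + B ^ 2 = 1) (hδ : 0 ≤ δ) (u v : H)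
    (h : δ ≤ |‖(A : ℂ) • u + (B : ℂ) • v‖ ^ 2 / (‖u‖ ^ 2 + ‖v‖ ^ 2) - A ^ 2|) :
    δ ^ 2 * (‖u‖ ^ 2 + ‖v‖ ^ 2) ≤ ‖v‖ ^ 2 := by
  rcases eq_or_lt_of_le (show 0 ≤ ‖u‖ ^ 2 + ‖v‖ ^ 2 by positivity) with hN | hN
  · rw [← hN]; simp
  set y := RCLike.re (inner ℂ u v) with hy
  have hexp := norm_sq_add_smul A B u v
  rw [← hy] at hexp
  have hcs : y ^ 2 ≤ ‖u‖ ^ 2 * ‖v‖ ^ 2 := by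
    rw [← mul_pow, ← sq_abs]
    exact pow_le_pow_left₀ (abs_nonneg _)
      ((RCLike.abs_re_le_norm _).trans (norm_inner_le_norm u v)) 2
  set N := ‖u‖ ^ 2 + ‖v‖ ^ 2 with hNdef
  -- the difference of the two probabilities, times `N`, is
  -- `(B² - A²) ‖v‖² + 2 A B y`; since `((B² - A²), 2 A B)` is a unit vector, Cauchy-Schwarz applies
  have h2 : δ ^ 2 * N ^ 2 ≤ ((B ^ 2 - A ^ 2) * ‖v‖ ^ 2 + 2 * (A * B) * y) ^ 2 := by
    have e : (B ^ 2 - A ^ 2) * ‖v‖ ^ 2 + 2 * (A * B) * y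
        = (‖(A : ℂ) • u + (B : ℂ) • v‖ ^ 2 / N - A ^ 2) * N := by
      rw [sub_mul _ _ N, div_mul_cancel₀ _ hN.ne', hexp, hNdef]; ring
    rw [e, mul_pow]
    refine mul_le_mul_of_nonneg_right ?_ (sq_nonneg _)
    rw [← sq_abs (_ - _)]
    exact pow_le_pow_left₀ hδ h 2
  have h3 : ((B ^ 2 - A ^ 2) * ‖v‖ ^ 2 + 2 * (A * B) * y) ^ 2 ≤ ‖v‖ ^ 2 * N := by
    have e : ((B ^ 2 - A ^ 2) * ‖v‖ ^ 2 + 2 * (A * B) * y) ^ 2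
        + ((B ^ 2 - A ^ 2) * y - 2 * (A * B) * ‖v‖ ^ 2) ^ 2
        = (A ^ 2 + B ^ 2) ^ 2 * (‖v‖ ^ 2 * ‖v‖ ^ 2 + y ^ 2) := by ring
    rw [hAB] at e
    nlinarith [sq_nonneg ((B ^ 2 - A ^ 2) * y - 2 * (A * B) * ‖v‖ ^ 2)]
  have h4 : δ ^ 2 * N * N ≤ ‖v‖ ^ 2 * N := by nlinarith
  exact le_of_mul_le_mul_right h4 hN

/-- Helstrom's bound for the states `c e₀ ± s e₁`, where `e₀` and `e₁` are orthogonal and of equal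
norm. -/
theorem helstrom {G G' : H →L[ℂ] H} (hG : G.IsPositive) (hG' : G'.IsPositive)
    (hGG : (ContinuousLinearMap.id ℂ H - (G + G')).IsPositive) {c s N : ℝ} (hcs : 0 ≤ c * s)
    (h1 : c ^ 2 + s ^ 2 = 1) {e₀ e₁ : H} (h₀₁ : RCLike.re (inner ℂ e₀ e₁) = 0)
    (he₀ : ‖e₀‖ ^ 2 = N) (he₁ : ‖e₁‖ ^ 2 = N) :
    G.reApplyInnerSelf ((c : ℂ) • e₀ + (s : ℂ) • e₁)
      + G'.reApplyInnerSelf ((c : ℂ) • e₀ + ((-s : ℝ) : ℂ) • e₁) ≤ (1 + 2 * (c * s)) * N := by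
  have hnorm (A B : ℝ) : ‖(A : ℂ) • e₀ + (B : ℂ) • e₁‖ ^ 2 = (A ^ 2 + B ^ 2) * N := by
    rw [norm_sq_add_smul, he₀, he₁, h₀₁]; ring
  have hsub (v : H) : G'.reApplyInnerSelf v ≤ ‖v‖ ^ 2 - G.reApplyInnerSelf v := by
    have h := reApplyInnerSelf_nonneg hGG v
    rw [reApplyInnerSelf_sub_op, reApplyInnerSelf_id] at h
    have : (G + G').reApplyInnerSelf v = G.reApplyInnerSelf v + G'.reApplyInnerSelf v := by
      simp [ContinuousLinearMap.reApplyInnerSelf_apply, inner_add_left]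
    linarith
  have hup : G.reApplyInnerSelf (((1 : ℝ) : ℂ) • e₀ + ((1 : ℝ) : ℂ) • e₁) ≤ 2 * N := by
    -- the upper bound at `e₀ + e₁` uses that `G'` is positive too
    have h := reApplyInnerSelf_nonneg hG' (((1 : ℝ) : ℂ) • e₀ + ((1 : ℝ) : ℂ) • e₁)
    have h' := hsub (((1 : ℝ) : ℂ) • e₀ + ((1 : ℝ) : ℂ) • e₁)
    rw [hnorm] at h'
    linarith
  have hlow := reApplyInnerSelf_nonneg hG (((1 : ℝ) : ℂ) • e₀ + ((-1 : ℝ) : ℂ) • e₁)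
  have hm := hsub ((c : ℂ) • e₀ + ((-s : ℝ) : ℂ) • e₁)
  rw [hnorm] at hm
  rw [reApplyInnerSelf_add hG] at hup hlow hm ⊢
  nlinarith
end Forms

/-! ### The agreed states and the measurement basis -/

/-- The unit vector orthogonal to `psi θ a`. -/
noncomputable def perp (θ : ℝ) (a : Bool) : Qubit :=
  WithLp.toLp 2 (fun q =>
    if q then ((Real.cos (θ / 2) : ℝ) : ℂ)
    else (if a then ((Real.sin (θ / 2) : ℝ) : ℂ) else -((Real.sin (θ / 2) : ℝ) : ℂ)))

/-- The overlap `⟨pm b|psi θ a⟩`. -/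
noncomputable def overlap (θ : ℝ) (a b : Bool) : ℝ :=
  (√2)⁻¹ * (Real.cos (θ / 2) + if xor a b then -Real.sin (θ / 2) else Real.sin (θ / 2))

/-- The overlap `⟨pm b|perp θ a⟩`. -/
noncomputable def overlapPerp (θ : ℝ) (a b : Bool) : ℝ :=
  (√2)⁻¹ * ((if b then -Real.cos (θ / 2) else Real.cos (θ / 2))
    - if a then -Real.sin (θ / 2) else Real.sin (θ / 2))

theorem inv_sqrt_two_sq : (√2)⁻¹ ^ 2 = (1 / 2 : ℝ) := by
  rw [inv_pow, Real.sq_sqrt (by norm_num)]; norm_num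

theorem sin_eq_two_mul_half (θ : ℝ) :
    Real.sin θ = 2 * Real.sin (θ / 2) * Real.cos (θ / 2) := by
  rw [← Real.sin_two_mul]; congr 1; ring

theorem overlap_sq (θ : ℝ) (a b : Bool) : overlap θ a b ^ 2 = ideal θ a b := by
  have h1 := Real.sin_sq_add_cos_sq (θ / 2)
  rw [overlap, mul_pow, inv_sqrt_two_sq, ideal, pMax, pMin, sin_eq_two_mul_half θ]
  cases a <;> cases b <;> simp <;> linear_combination (1 / 2) * h1

theorem overlap_sq_add_overlapPerp_sq (θ : ℝ) (a b : Bool) :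
    overlap θ a b ^ 2 + overlapPerp θ a b ^ 2 = 1 := by
  have h1 := Real.sin_sq_add_cos_sq (θ / 2)
  rw [overlap, overlapPerp, mul_pow, mul_pow, inv_sqrt_two_sq]
  cases a <;> cases b <;> simp <;> linear_combination h1

theorem pMin_nonneg (θ : ℝ) : 0 ≤ pMin θ := by
  have := Real.sin_le_one θ; rw [pMin]; linarith

theorem pMax_nonneg (θ : ℝ) : 0 ≤ pMax θ := by
  have := Real.neg_one_le_sin θ; rw [pMax]; linarith

theorem pMin_add_pMax (θ : ℝ) : pMin θ + pMax θ = 1 := by rw [pMin, pMax]; ring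

theorem ideal_nonneg (θ : ℝ) (w c : Bool) : 0 ≤ ideal θ w c := by
  rw [ideal]; split_ifs; exacts [pMax_nonneg θ, pMin_nonneg θ]

/-- The statistics of the measurement in the basis `|±⟩` are the ideal ones for the wish
`w = b ⊕ b'` and the outcome `c = a ⊕ b`. -/
theorem ideal_xor (θ : ℝ) (a b w : Bool) : ideal θ a (xor b w) = ideal θ w (xor a b) := by
  cases a <;> cases b <;> cases w <;> rfl

section Tensor

variable {H : Type u} [NormedAddCommGroup H] [InnerProductSpace ℂ H]

theorem contract_pm (θ : ℝ) (a b : Bool) (Φ : WithQubit H) :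
    contract (pm b) Φ = (overlap θ a b : ℂ) • contract (psi θ a) Φ
      + (overlapPerp θ a b : ℂ) • contract (perp θ a) Φ := by
  have h1 : ((Real.sin (θ / 2) : ℝ) : ℂ) ^ 2 + ((Real.cos (θ / 2) : ℝ) : ℂ) ^ 2 = 1 := by
    exact_mod_cast Real.sin_sq_add_cos_sq (θ / 2)
  simp only [contract, Fintype.sum_bool, smul_add, smul_smul]
  rw [add_add_add_comm, ← add_smul, ← add_smul]
  congr 2
  all_goals
    cases a <;> cases b <;>
      simp [pm, psi, perp, overlap, overlapPerp, -Complex.ofReal_sin, -Complex.ofReal_cos] <;>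
      first
      | linear_combination (-(√2 : ℂ)⁻¹) * h1
      | linear_combination ((√2 : ℂ)⁻¹) * h1

theorem norm_contract_psi_sq_add (θ : ℝ) (a : Bool) (Φ : WithQubit H) :
    ‖contract (psi θ a) Φ‖ ^ 2 + ‖contract (perp θ a) Φ‖ ^ 2 = ‖Φ‖ ^ 2 := by
  have h1 := Real.sin_sq_add_cos_sq (θ / 2)
  have e1 : contract (psi θ a) Φ = (((if a then -Real.sin (θ / 2) else Real.sin (θ / 2) : ℝ) : ℂ))
      • Φ true + ((Real.cos (θ / 2) : ℝ) : ℂ) • Φ false := by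
    simp only [contract, Fintype.sum_bool, psi]
    cases a <;> simp [-Complex.ofReal_sin, -Complex.ofReal_cos]
  have e2 : contract (perp θ a) Φ = ((Real.cos (θ / 2) : ℝ) : ℂ) • Φ true
      + (((if a then Real.sin (θ / 2) else -Real.sin (θ / 2) : ℝ) : ℂ)) • Φ false := by
    simp only [contract, Fintype.sum_bool, perp]
    cases a <;> simp [-Complex.ofReal_sin, -Complex.ofReal_cos]
  rw [e1, e2, norm_sq_add_smul, norm_sq_add_smul, PiLp.norm_sq_eq_of_L2, Fintype.sum_bool]
  cases a <;> simp <;> linear_combination (‖Φ true‖ ^ 2 + ‖Φ false‖ ^ 2) * h1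

theorem norm_tensor (θ : ℝ) (a : Bool) (v : H) : ‖tensor (psi θ a) v‖ = ‖v‖ := by
  have h1 := Real.sin_sq_add_cos_sq (θ / 2)
  refine (sq_eq_sq₀ (norm_nonneg _) (norm_nonneg _)).1 ?_
  rw [PiLp.norm_sq_eq_of_L2, Fintype.sum_bool]
  cases a <;> simp [tensor, psi, norm_smul, mul_pow, -Complex.ofReal_sin, -Complex.ofReal_cos] <;>
    linear_combination (‖v‖ ^ 2) * h1

end Tensor

/-! ### Honest runs -/

theorem sum_fin_succ_arrow {X β : Type*} [Fintype X] [AddCommMonoid β] (n : ℕ)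
    (f : (Fin n → X) → X → β) :
    ∑ x : Fin (n + 1) → X, f (Fin.init x) (x (Fin.last n)) = ∑ x, ∑ y, f x y := by
  rw [← (Fin.snocEquiv (fun _ : Fin (n + 1) => X)).sum_comp, Fintype.sum_prod_type_right]
  simp [Fin.snocEquiv]

theorem inner_pm_psi (θ : ℝ) (a b : Bool) : inner ℂ (pm b) (psi θ a) = (overlap θ a b : ℂ) := by
  simp only [PiLp.inner_apply, Fintype.sum_bool]
  cases a <;> cases b <;>
    simp [pm, psi, overlap, -Complex.ofReal_sin, -Complex.ofReal_cos] <;> ring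

theorem tensor_one (φ : Qubit) : tensor φ (1 : ℂ) = φ := by
  ext q; simp [tensor]

theorem tensor_zero {H : Type u} [NormedAddCommGroup H] [InnerProductSpace ℂ H] (φ : Qubit) :
    tensor φ (0 : H) = 0 := by
  ext q; simp [tensor]

theorem contract_tensor {H : Type u} [NormedAddCommGroup H] [InnerProductSpace ℂ H]
    (φ χ : Qubit) (v : H) : contract φ (tensor χ v) = (inner ℂ φ χ : ℂ) • v := by
  simp only [contract, tensor, PiLp.inner_apply, Finset.sum_smul, smul_smul, RCLike.inner_apply,
    mul_comm]

theorem inner_psi_self (θ : ℝ) (a : Bool) : inner ℂ (psi θ a) (psi θ a) = (1 : ℂ) := by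
  have h := norm_tensor θ a (1 : ℂ)
  rw [tensor_one] at h
  rw [inner_self_eq_norm_sq_to_K, h]; simp

theorem honestAlice_emit (θ : ℝ) (i : ℕ) (v : ℂ) (a : Bool) :
    (honestAlice θ).emit i v a = tensor (psi θ a) ((((√2)⁻¹ : ℝ) : ℂ) * v) := by
  ext q
  simp only [AliceStrategy.emit, honestAlice, tensor, LinearIsometry.coe_mk, LinearMap.coe_mk,
    AddHom.coe_mk, honestAmp, smul_eq_mul]
  ring

theorem honestAlice_passed (θ : ℝ) (n : ℕ) (x : Fin n → Bool) :
    (honestAlice θ).passed θ n x = ((((√2)⁻¹ ^ n : ℝ)) : ℂ) := by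
  induction n with
  | zero => simp [AliceStrategy.passed, honestAlice]
  | succ n ih =>
    change contract (psi θ (x (Fin.last n)))
      ((honestAlice θ).emit n ((honestAlice θ).passed θ n (Fin.init x)) (x (Fin.last n))) = _
    rw [honestAlice_emit, contract_tensor, ih, inner_psi_self, one_smul, ← Complex.ofReal_mul,
      pow_succ']

theorem honestLik_eq (θ : ℝ) (n : ℕ) (x : Fin (n + 1) → Bool) (b w : Bool) :
    honestLik θ n x b w = ideal θ w (xor (x (Fin.last n)) b) * (1 / 2) ^ (n + 1) := by
  have h : (honestAlice θ).coin θ n x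
      = tensor (psi θ (x (Fin.last n))) ((((√2)⁻¹ ^ (n + 1) : ℝ)) : ℂ) := by
    change (honestAlice θ).emit n ((honestAlice θ).passed θ n (Fin.init x)) (x (Fin.last n)) = _
    rw [honestAlice_emit, honestAlice_passed, ← Complex.ofReal_mul, pow_succ']
  rw [honestLik, h, contract_tensor, inner_pm_psi, norm_smul, mul_pow, Complex.norm_real,
    Complex.norm_real, Real.norm_eq_abs, Real.norm_eq_abs, sq_abs, sq_abs, overlap_sq, ideal_xor,
    ← pow_mul, mul_comm (n + 1), pow_mul, inv_sqrt_two_sq]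

theorem honestAlice_outcomeAt (θ : ℝ) (w c : Bool) (n : ℕ) :
    (honestAlice θ).outcomeAt θ w c n = ideal θ w c := by
  have h (x : Fin (n + 1) → Bool) : (∑ b' : Bool,
      if ((honestAlice θ).ann (x (Fin.last n))).map (fun a => xor a (xor b' w)) = some c
      then ‖contract (pm b') ((honestAlice θ).coin θ n x)‖ ^ 2 else 0)
      = ideal θ w c * (1 / 2) ^ (n + 1) := by
    have e (b' : Bool) : ‖contract (pm b') ((honestAlice θ).coin θ n x)‖ ^ 2
        = ideal θ w (xor (x (Fin.last n)) (xor b' w)) * (1 / 2) ^ (n + 1) := by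
      rw [← honestLik_eq, honestLik]; simp
    have ea (a : Bool) : (honestAlice θ).ann a = some a := rfl
    simp only [e, ea, Option.map_some, Option.some.injEq]
    generalize x (Fin.last n) = a
    cases a <;> cases w <;> cases c <;> simp
  rw [AliceStrategy.outcomeAt, Finset.sum_congr rfl fun x _ => h x]
  simp only [Finset.sum_const, Finset.card_univ, Fintype.card_fun, Fintype.card_bool,
    Fintype.card_fin, nsmul_eq_mul]
  push_cast
  rw [mul_left_comm, ← mul_pow]; norm_num

theorem posterior_mul_const (π ℓ : Bool → ℝ) {k : ℝ} (hk : k ≠ 0) :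
    posterior π (fun w => ℓ w * k) = posterior π ℓ := by
  funext w
  simp only [posterior, ← mul_assoc, ← Finset.sum_mul]
  exact mul_div_mul_right _ _ hk

/-! ### Security against Bob -/

section Bob

variable {L : Type u} [NormedAddCommGroup L] [InnerProductSpace ℂ L]

/-- Helstrom's bound for the two agreed states in the presence of an ancilla. -/
theorem helstrom_tensor {θ : ℝ} (hθ : 0 ≤ Real.sin θ) {G G' : WithQubit L →L[ℂ] WithQubit L}
    (hG : G.IsPositive) (hG' : G'.IsPositive)
    (hGG : (ContinuousLinearMap.id ℂ (WithQubit L) - (G + G')).IsPositive) (v : L) :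
    G.reApplyInnerSelf (tensor (psi θ false) v) + G'.reApplyInnerSelf (tensor (psi θ true) v)
      ≤ 2 * pMax θ * ‖v‖ ^ 2 := by
  have hs := sin_eq_two_mul_half θ
  set e : Bool → WithQubit L := fun r => WithLp.toLp 2 (fun q => if q = r then v else 0) with he
  have hn (r : Bool) : ‖e r‖ ^ 2 = ‖v‖ ^ 2 := by
    rw [PiLp.norm_sq_eq_of_L2, Fintype.sum_bool]; cases r <;> simp [he]
  have h := helstrom hG hG' hGG (c := Real.cos (θ / 2)) (s := Real.sin (θ / 2))
    (e₀ := e false) (e₁ := e true) (by linarith) (Real.cos_sq_add_sin_sq _)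
    (by simp [he, PiLp.inner_apply]) (hn _) (hn _)
  have e1 : tensor (psi θ false) v = ((Real.cos (θ / 2) : ℝ) : ℂ) • e false
      + ((Real.sin (θ / 2) : ℝ) : ℂ) • e true := by
    ext q; cases q <;> simp [tensor, psi, he, -Complex.ofReal_sin, -Complex.ofReal_cos]
  have e2 : tensor (psi θ true) v = ((Real.cos (θ / 2) : ℝ) : ℂ) • e false
      + ((-Real.sin (θ / 2) : ℝ) : ℂ) • e true := by
    ext q; cases q <;> simp [tensor, psi, he, -Complex.ofReal_sin, -Complex.ofReal_cos]
  rw [← e1, ← e2] at h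
  rw [pMax, hs]
  linarith

namespace BobStrategy

variable (B : BobStrategy L) (θ : ℝ)

/-- Probability that Bob has not yet announced the coin round after `n` rounds. -/
noncomputable def weight (n : ℕ) : ℝ :=
  ∑ a : Fin n → Bool, (1 / 2) ^ n * ‖B.state θ n a‖ ^ 2

/-- Probability that Bob announces round `n` as the coin round. -/
noncomputable def coinWeight (n : ℕ) : ℝ :=
  ∑ a : Fin n → Bool, (1 / 2) ^ n * ‖B.choose n (B.state θ n a) true‖ ^ 2

theorem coinWeight_nonneg (n : ℕ) : 0 ≤ B.coinWeight θ n :=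
  Finset.sum_nonneg fun _ _ => by positivity

theorem weight_nonneg (n : ℕ) : 0 ≤ B.weight θ n :=
  Finset.sum_nonneg fun _ _ => by positivity

theorem weight_succ_add_coinWeight_le (n : ℕ) :
    B.weight θ (n + 1) + B.coinWeight θ n ≤ B.weight θ n := by
  have h1 : B.weight θ (n + 1) = ∑ x : Fin n → Bool, ∑ a, (1 / 2) ^ (n + 1) *
      ‖B.absorb n a (tensor (psi θ a) (B.choose n (B.state θ n x) false))‖ ^ 2 :=
    sum_fin_succ_arrow n fun x a => (1 / 2 : ℝ) ^ (n + 1) *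
      ‖B.absorb n a (tensor (psi θ a) (B.choose n (B.state θ n x) false))‖ ^ 2
  rw [h1, weight, coinWeight, ← Finset.sum_add_distrib]
  refine Finset.sum_le_sum fun x _ => ?_
  set v := B.state θ n x
  have ha (a : Bool) : ‖B.absorb n a (tensor (psi θ a) (B.choose n v false))‖ ^ 2
      ≤ ‖B.choose n v false‖ ^ 2 := by
    refine pow_le_pow_left₀ (norm_nonneg _) ?_ 2
    have := (B.absorb n a).le_of_opNorm_le (B.norm_absorb_le n a)
      (tensor (psi θ a) (B.choose n v false))
    rwa [one_mul, norm_tensor] at this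
  have hc : ‖B.choose n v true‖ ^ 2 + ‖B.choose n v false‖ ^ 2 ≤ ‖v‖ ^ 2 := by
    have := (B.choose n).le_of_opNorm_le (B.norm_choose_le n) v
    have := pow_le_pow_left₀ (norm_nonneg _) this 2
    rwa [one_mul, PiLp.norm_sq_eq_of_L2, Fintype.sum_bool] at this
  have hp : (0 : ℝ) ≤ (1 / 2) ^ n := by positivity
  rw [Fintype.sum_bool, pow_succ]
  nlinarith [ha true, ha false, mul_le_mul_of_nonneg_left (ha true) hp,
    mul_le_mul_of_nonneg_left (ha false) hp, mul_le_mul_of_nonneg_left hc hp]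

theorem sum_coinWeight_le (n : ℕ) : ∑ i ∈ Finset.range n, B.coinWeight θ i ≤ 1 := by
  have h : ∑ i ∈ Finset.range n, B.coinWeight θ i + B.weight θ n ≤ 1 := by
    induction n with
    | zero => simp [weight, state, B.norm_init]
    | succ n ih =>
      rw [Finset.sum_range_succ]
      linarith [B.weight_succ_add_coinWeight_le θ n]
  linarith [B.weight_nonneg θ n]

theorem summable_coinWeight : Summable (B.coinWeight θ) :=
  summable_of_sum_range_le (B.coinWeight_nonneg θ) (B.sum_coinWeight_le θ)

theorem tsum_coinWeight_le : ∑' n, B.coinWeight θ n ≤ 1 :=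
  (B.summable_coinWeight θ).tsum_le_of_sum_range_le (B.sum_coinWeight_le θ)

theorem outcomeAt_eq (c : Bool) (n : ℕ) :
    B.outcomeAt θ c n = ∑ x : Fin n → Bool, (1 / 2) ^ n * (1 / 2 * ∑ a,
      (B.guess n (xor a c)).reApplyInnerSelf
        (tensor (psi θ a) (B.choose n (B.state θ n x) true))) := by
  have h := sum_fin_succ_arrow n fun x a => (1 / 2 : ℝ) ^ (n + 1) *
    (B.guess n (xor a c)).reApplyInnerSelf
      (tensor (psi θ a) (B.choose n (B.state θ n x) true))
  rw [outcomeAt, h]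
  simp only [← Finset.mul_sum, pow_succ, mul_assoc]

theorem outcomeAt_nonneg (c : Bool) (n : ℕ) : 0 ≤ B.outcomeAt θ c n :=
  Finset.sum_nonneg fun _ _ => mul_nonneg (by positivity)
    (reApplyInnerSelf_nonneg (B.guess_pos _ _) _)

theorem guess_le' (i : ℕ) (c : Bool) : (ContinuousLinearMap.id ℂ (WithQubit L)
    - (B.guess i c + B.guess i (!c))).IsPositive := by
  have h := B.guess_le i
  rw [Fintype.sum_bool] at h
  cases c
  · rwa [add_comm]
  · exact h

theorem outcomeAt_le {θ : ℝ} (hθ : 0 ≤ Real.sin θ) (c : Bool) (n : ℕ) :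
    B.outcomeAt θ c n ≤ pMax θ * B.coinWeight θ n := by
  rw [outcomeAt_eq, coinWeight, Finset.mul_sum]
  refine Finset.sum_le_sum fun x _ => ?_
  rw [mul_left_comm (pMax θ)]
  refine mul_le_mul_of_nonneg_left ?_ (by positivity)
  have h := helstrom_tensor hθ (B.guess_pos n c) (B.guess_pos n (!c)) (B.guess_le' n c)
    (B.choose n (B.state θ n x) true)
  rw [Fintype.sum_bool, Bool.true_xor, Bool.false_xor]
  linarith

theorem outcomeAt_add_le (n : ℕ) :
    B.outcomeAt θ false n + B.outcomeAt θ true n ≤ B.coinWeight θ n := by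
  rw [outcomeAt_eq, outcomeAt_eq, coinWeight, ← Finset.sum_add_distrib]
  refine Finset.sum_le_sum fun x _ => ?_
  rw [← mul_add]
  refine mul_le_mul_of_nonneg_left ?_ (by positivity)
  set v := B.choose n (B.state θ n x) true
  have h (a : Bool) : (B.guess n false).reApplyInnerSelf (tensor (psi θ a) v)
      + (B.guess n true).reApplyInnerSelf (tensor (psi θ a) v) ≤ ‖v‖ ^ 2 := by
    have := reApplyInnerSelf_le_norm_sq (B.guess_le n) (tensor (psi θ a) v)
    rwa [reApplyInnerSelf_sum, Fintype.sum_bool, norm_tensor, add_comm] at this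
  have h0 := h false
  have h1 := h true
  simp only [Fintype.sum_bool, Bool.xor_false, Bool.xor_true, Bool.not_true, Bool.not_false]
  linarith

theorem summable_outcomeAt {θ : ℝ} (hθ : 0 ≤ Real.sin θ) (c : Bool) :
    Summable (B.outcomeAt θ c) :=
  Summable.of_nonneg_of_le (B.outcomeAt_nonneg θ c) (B.outcomeAt_le hθ c)
    ((B.summable_coinWeight θ).mul_left _)

theorem outcomeProb_le {θ : ℝ} (hθ : 0 ≤ Real.sin θ) (c : Bool) :
    B.outcomeProb θ c ≤ pMax θ :=
  calc B.outcomeProb θ c ≤ ∑' n, pMax θ * B.coinWeight θ n :=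
        (B.summable_outcomeAt hθ c).tsum_le_tsum (B.outcomeAt_le hθ c)
          ((B.summable_coinWeight θ).mul_left _)
    _ = pMax θ * ∑' n, B.coinWeight θ n := tsum_mul_left
    _ ≤ pMax θ := mul_le_of_le_one_right (pMax_nonneg θ) (B.tsum_coinWeight_le θ)

theorem outcomeProb_add_le {θ : ℝ} (hθ : 0 ≤ Real.sin θ) :
    B.outcomeProb θ false + B.outcomeProb θ true ≤ 1 := by
  rw [outcomeProb, outcomeProb, ← (B.summable_outcomeAt hθ _).tsum_add (B.summable_outcomeAt hθ _)]
  exact (((B.summable_outcomeAt hθ _).add (B.summable_outcomeAt hθ _)).tsum_le_tsum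
    (B.outcomeAt_add_le θ) (B.summable_coinWeight θ)).trans (B.tsum_coinWeight_le θ)

/-- Both outcome probabilities are at most `pMax θ` and they add up to at most `1`; so they are
dominated by a coin whose bias lies in the agreed range. -/
theorem exists_bias {θ : ℝ} (hθ : 0 ≤ Real.sin θ) :
    ∃ p ∈ Set.Icc (pMin θ) (pMax θ),
      B.outcomeProb θ false ≤ p ∧ B.outcomeProb θ true ≤ 1 - p := by
  have h0 := B.outcomeProb_le hθ false
  have h1 := B.outcomeProb_le hθ true
  have h2 := B.outcomeProb_add_le hθ
  have h3 := pMin_add_pMax θ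
  have h4 : pMin θ ≤ pMax θ := by rw [pMin, pMax]; linarith
  refine ⟨max (B.outcomeProb θ false) (pMin θ), ⟨le_max_right _ _, max_le h0 h4⟩,
    le_max_left _ _, ?_⟩
  rcases max_cases (B.outcomeProb θ false) (pMin θ) with h | h <;> linarith

end BobStrategy

end Bob

/-! ### The range of biases -/

theorem reApplyInnerSelf_rankOne_self {H : Type u} [NormedAddCommGroup H] [InnerProductSpace ℂ H]
    (x y : H) : (InnerProductSpace.rankOne ℂ x x).reApplyInnerSelf y = ‖(inner ℂ x y : ℂ)‖ ^ 2 := by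
  rw [ContinuousLinearMap.reApplyInnerSelf_apply, InnerProductSpace.rankOne_apply, inner_smul_left,
    RCLike.conj_mul]
  norm_cast

theorem rankOne_pm_add :
    InnerProductSpace.rankOne ℂ (pm true) (pm true)
        + InnerProductSpace.rankOne ℂ (pm false) (pm false)
      = ContinuousLinearMap.id ℂ Qubit := by
  have h : (((√2)⁻¹ : ℝ) : ℂ) ^ 2 = 1 / 2 := by
    rw [← Complex.ofReal_pow, inv_sqrt_two_sq]; norm_num
  push_cast at h
  ext v q
  cases q <;> simp [pm, PiLp.inner_apply]
  · linear_combination (2 * v false) * h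
  · linear_combination (2 * v true) * h

/-- Bob announces the first round as the coin round, measures in the basis `|±⟩`, and inverts the
result with probability `1 - q`. -/
noncomputable def mixedBob (q : ℝ) (h0 : 0 ≤ q) (h1 : q ≤ 1) : BobStrategy ℂ where
  init := 1
  norm_init := norm_one
  choose := fun _ => ContinuousLinearMap.toSpanSingleton ℂ (EuclideanSpace.single true (1 : ℂ))
  norm_choose_le := fun _ => by simp
  absorb := fun _ _ => 0
  norm_absorb_le := fun _ _ => by simp
  guess := fun _ b => (q : ℂ) • InnerProductSpace.rankOne ℂ (pm b) (pm b)
    + ((1 - q : ℝ) : ℂ) • InnerProductSpace.rankOne ℂ (pm !b) (pm !b)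
  guess_pos := fun _ b => by
    refine ContinuousLinearMap.IsPositive.add ?_ ?_
    · exact (InnerProductSpace.isPositive_rankOne_self _).smul_of_nonneg (by exact_mod_cast h0)
    · exact (InnerProductSpace.isPositive_rankOne_self _).smul_of_nonneg
        (by exact_mod_cast sub_nonneg.2 h1)
  guess_le := fun _ => by
    have h : ∑ b, ((q : ℂ) • InnerProductSpace.rankOne ℂ (pm b) (pm b)
        + ((1 - q : ℝ) : ℂ) • InnerProductSpace.rankOne ℂ (pm !b) (pm !b))
        = ContinuousLinearMap.id ℂ Qubit := by
      rw [← rankOne_pm_add, Fintype.sum_bool]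
      push_cast
      simp only [Bool.not_true, Bool.not_false]
      module
    change (ContinuousLinearMap.id ℂ Qubit - ∑ b, _).IsPositive
    rw [h, sub_self]
    exact ContinuousLinearMap.isPositive_zero

theorem mixedBob_outcomeProb (θ q : ℝ) (h0 : 0 ≤ q) (h1 : q ≤ 1) (c : Bool) :
    (mixedBob q h0 h1).outcomeProb θ c = q * ideal θ false c + (1 - q) * ideal θ true c := by
  have hz (n : ℕ) (hn : n ≠ 0) : (mixedBob q h0 h1).outcomeAt θ c n = 0 := by
    obtain ⟨m, rfl⟩ := Nat.exists_eq_succ_of_ne_zero hn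
    refine Finset.sum_eq_zero fun a _ => ?_
    have : (mixedBob q h0 h1).state θ (m + 1) (Fin.init a) = 0 := rfl
    rw [this]
    simp [tensor_zero, ContinuousLinearMap.reApplyInnerSelf_apply]
  have hv (x : Fin 0 → Bool) :
      (mixedBob q h0 h1).choose 0 ((mixedBob q h0 h1).state θ 0 x) true = (1 : ℂ) := by
    change ((1 : ℂ) • (EuclideanSpace.single true (1 : ℂ) : Qubit)) true = 1
    simp
  have hg (a b : Bool) : ((mixedBob q h0 h1).guess 0 b).reApplyInnerSelf (psi θ a)
      = q * ideal θ a b + (1 - q) * ideal θ a (!b) := by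
    have hr (b : Bool) : (InnerProductSpace.rankOne ℂ (pm b) (pm b)).reApplyInnerSelf (psi θ a)
        = ideal θ a b := by
      rw [reApplyInnerSelf_rankOne_self, inner_pm_psi, Complex.norm_real, Real.norm_eq_abs, sq_abs,
        overlap_sq]
    change ((q : ℂ) • InnerProductSpace.rankOne ℂ (pm b) (pm b) + ((1 - q : ℝ) : ℂ) •
      InnerProductSpace.rankOne ℂ (pm !b) (pm !b)).reApplyInnerSelf (psi θ a) = _
    rw [← hr b, ← hr (!b)]
    simp only [ContinuousLinearMap.reApplyInnerSelf_apply, _root_.add_apply,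
      _root_.smul_apply, inner_add_left, map_add, inner_smul_left,
      Complex.conj_ofReal, RCLike.re_eq_complex_re, Complex.re_ofReal_mul]
  rw [BobStrategy.outcomeProb, tsum_eq_single 0 hz, BobStrategy.outcomeAt_eq, Fintype.sum_unique,
    hv]
  simp only [tensor_one, hg]
  cases c <;> simp [ideal] <;> ring

theorem achievableBiases_eq {θ : ℝ} (hθ : 0 ≤ Real.sin θ) :
    achievableBiases θ = Set.Icc (pMin θ) (pMax θ) := by
  ext p
  constructor
  · rintro ⟨L, _, _, _, B, hf, ht⟩
    obtain ⟨p', hp', h1, h2⟩ := B.exists_bias hθ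
    have : p = p' := by linarith
    rwa [this]
  · rintro ⟨hl, hr⟩
    obtain ⟨s, t, hs, ht, hst, hp⟩ : p ∈ segment ℝ (pMin θ) (pMax θ) := by
      rw [segment_eq_Icc (hl.trans hr)]; exact ⟨hl, hr⟩
    have hm := pMin_add_pMax θ
    simp only [smul_eq_mul] at hp
    refine ⟨ℂ, inferInstance, inferInstance, inferInstance,
      mixedBob t ht (by linarith), ?_, ?_⟩ <;> rw [mixedBob_outcomeProb] <;> simp [ideal]
    · rw [← hp, ← hst]; ring
    · rw [← hp]
      linear_combination pMin θ * hst + hm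

theorem exists_achievableBiases_eq_iff {x y : ℝ} (hxy : x < y) :
    (∃ t ∈ Set.Icc 0 (Real.pi / 2), achievableBiases t = Set.Icc x y) ↔ 0 ≤ x ∧ x + y = 1 := by
  have hsin {t : ℝ} (ht : t ∈ Set.Icc 0 (Real.pi / 2)) : 0 ≤ Real.sin t :=
    Real.sin_nonneg_of_nonneg_of_le_pi ht.1 (by linarith [ht.2, Real.pi_pos])
  constructor
  · rintro ⟨t, ht, h⟩
    have hs := hsin ht
    rw [achievableBiases_eq hs] at h
    have hle : pMin t ≤ pMax t := by rw [pMin, pMax]; linarith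
    obtain ⟨rfl, rfl⟩ := (Set.Icc_eq_Icc_iff hle).1 h
    exact ⟨pMin_nonneg t, pMin_add_pMax t⟩
  · rintro ⟨hx, h1⟩
    have ht : Real.arcsin (1 - 2 * x) ∈ Set.Icc 0 (Real.pi / 2) :=
      ⟨Real.arcsin_nonneg.2 (by linarith), Real.arcsin_le_pi_div_two _⟩
    refine ⟨_, ht, ?_⟩
    rw [achievableBiases_eq (hsin ht), pMin, pMax, Real.sin_arcsin (by linarith) (by linarith)]
    congr 1 <;> linarith

/-! ### Optimality of the measurement in the basis `|±⟩` -/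

theorem guessing_le_pMax {θ : ℝ} (hθ : 0 ≤ Real.sin θ) {E : Qubit →L[ℂ] Qubit}
    (hE : E.IsPositive) (hE' : (ContinuousLinearMap.id ℂ Qubit - E).IsPositive) :
    (E.reApplyInnerSelf (psi θ false)
      + (ContinuousLinearMap.id ℂ Qubit - E).reApplyInnerSelf (psi θ true)) / 2 ≤ pMax θ := by
  have hsub : (ContinuousLinearMap.id ℂ (WithQubit ℂ)
      - (E + (ContinuousLinearMap.id ℂ Qubit - E))).IsPositive := by
    rw [add_sub_cancel, sub_self]
    exact ContinuousLinearMap.isPositive_zero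
  have h := helstrom_tensor (L := ℂ) hθ hE hE' hsub 1
  rw [tensor_one, tensor_one, norm_one] at h
  linarith

theorem guessing_pm (θ : ℝ) :
    (‖inner ℂ (pm false) (psi θ false)‖ ^ 2 + ‖inner ℂ (pm true) (psi θ true)‖ ^ 2) / 2
      = pMax θ := by
  rw [inner_pm_psi, inner_pm_psi, Complex.norm_real, Complex.norm_real, Real.norm_eq_abs,
    Real.norm_eq_abs, sq_abs, sq_abs, overlap_sq, overlap_sq]
  simp [ideal]

/-! ### Averages over the number of rounds -/

theorem integrable_nat_of_abs_le (μ : Measure ℕ) [IsProbabilityMeasure μ] {f : ℕ → ℝ} {K : ℝ}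
    (hf : ∀ n, |f n| ≤ K) : Integrable f μ :=
  Integrable.of_bound (measurable_of_countable f).aestronglyMeasurable K (ae_of_all _ hf)

theorem le_one_of_sum_range_le {f : ℕ → ℝ} (h0 : ∀ n, 0 ≤ f n)
    (h1 : ∀ n, ∑ i ∈ Finset.range n, f i ≤ 1) (n : ℕ) : f n ≤ 1 := by
  have := h1 (n + 1)
  rw [Finset.sum_range_succ] at this
  linarith [Finset.sum_nonneg fun i (_ : i ∈ Finset.range n) => h0 i]

theorem integrable_of_sum_range_le (μ : Measure ℕ) [IsProbabilityMeasure μ] {f : ℕ → ℝ}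
    (h0 : ∀ n, 0 ≤ f n) (h1 : ∀ n, ∑ i ∈ Finset.range n, f i ≤ 1) : Integrable f μ :=
  integrable_nat_of_abs_le μ fun n => by
    rw [abs_of_nonneg (h0 n)]; exact le_one_of_sum_range_le h0 h1 n

/-- Events whose probabilities add up to at most `1` over all rounds hit the secret coin round
with probability at most the largest weight of its law. -/
theorem integral_le_of_sum_range_le (μ : Measure ℕ) [IsProbabilityMeasure μ] {f : ℕ → ℝ}
    (h0 : ∀ n, 0 ≤ f n) (h1 : ∀ n, ∑ i ∈ Finset.range n, f i ≤ 1) {C : ℝ}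
    (hC : ∀ n, μ.real {n} ≤ C) : ∫ n, f n ∂μ ≤ C := by
  have hC0 : 0 ≤ C := measureReal_nonneg.trans (hC 0)
  rw [integral_countable (integrable_of_sum_range_le μ h0 h1)]
  refine Real.tsum_le_of_sum_range_le (fun n => ?_) fun n => ?_
  · exact smul_nonneg measureReal_nonneg (h0 n)
  · calc ∑ i ∈ Finset.range n, μ.real {i} • f i ≤ ∑ i ∈ Finset.range n, C * f i :=
          Finset.sum_le_sum fun i _ => mul_le_mul_of_nonneg_right (hC i) (h0 i)
      _ = C * ∑ i ∈ Finset.range n, f i := by rw [Finset.mul_sum]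
      _ ≤ C := mul_le_of_le_one_right hC0 (h1 n)

/-! ### The largest weight of a Poisson law -/

theorem poissonMeasure_real_le_succ {r : ℝ≥0} {k : ℕ} (hk : ((k + 1 : ℕ) : ℝ) ≤ r) :
    (poissonMeasure r).real {k} ≤ (poissonMeasure r).real {k + 1} := by
  rw [poissonMeasure_real_singleton, poissonMeasure_real_singleton, Nat.factorial_succ, pow_succ]
  push_cast at hk ⊢
  rw [div_le_div_iff₀ (by positivity) (by positivity)]
  have h : (0 : ℝ) ≤ Real.exp (-r) * r ^ k * k.factorial := by positivity
  nlinarith [mul_le_mul_of_nonneg_left hk h]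

theorem poissonMeasure_real_le_of_le {r : ℝ≥0} {n m : ℕ} (hnm : n ≤ m) (hm : (m : ℝ) ≤ r) :
    (poissonMeasure r).real {n} ≤ (poissonMeasure r).real {m} := by
  induction m, hnm using Nat.le_induction with
  | base => exact le_rfl
  | succ k _ ih =>
    refine (ih (le_trans ?_ hm)).trans (poissonMeasure_real_le_succ hm)
    exact_mod_cast k.le_succ

theorem poissonMeasure_real_le_inv_sqrt (r : ℝ≥0) {n : ℕ} (hn : n ≠ 0) :
    (poissonMeasure r).real {n} ≤ (√(2 * Real.pi * n))⁻¹ := by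
  have hn0 : (0 : ℝ) < n := by positivity
  have hst := Stirling.le_factorial_stirling n
  have hpow : Real.exp (-r) * (r : ℝ) ^ n ≤ (n / Real.exp 1) ^ n := by
    have h1 : (r : ℝ) / n ≤ Real.exp (r / n - 1) := by
      have := Real.add_one_le_exp ((r : ℝ) / n - 1); linarith
    have h2 := pow_le_pow_left₀ (by positivity) h1 n
    rw [← Real.exp_nat_mul, mul_sub, mul_div_cancel₀ _ hn0.ne', mul_one, div_pow,
      div_le_iff₀ (by positivity), Real.exp_sub] at h2
    rw [div_pow, ← Real.exp_nat_mul, mul_one, Real.exp_neg]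
    calc (Real.exp r)⁻¹ * (r : ℝ) ^ n
        ≤ (Real.exp r)⁻¹ * (Real.exp r / Real.exp n * n ^ n) :=
          mul_le_mul_of_nonneg_left h2 (by positivity)
      _ = n ^ n / Real.exp n := by field_simp
  have hs : 0 < √(2 * Real.pi * n) := Real.sqrt_pos.2 (by positivity)
  rw [poissonMeasure_real_singleton, div_le_iff₀ (by positivity), ← div_eq_inv_mul,
    le_div_iff₀ hs]
  calc _ ≤ (n / Real.exp 1) ^ n * √(2 * Real.pi * n) := mul_le_mul_of_nonneg_right hpow hs.le
    _ ≤ n.factorial := by rwa [mul_comm]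

/-- An upper bound for the largest weight of the Poisson law of mean `r`. -/
noncomputable def poissonPeak (r : ℝ≥0) : ℝ := (√((⌊(r : ℝ)⌋₊ : ℝ) + 1))⁻¹

theorem poissonPeak_pos (r : ℝ≥0) : 0 < poissonPeak r :=
  inv_pos.2 (Real.sqrt_pos.2 (by positivity))

/-- The weights of the Poisson law increase up to `⌊r⌋`, and from there on Stirling's formula
bounds them. -/
theorem poissonMeasure_real_le_poissonPeak (r : ℝ≥0) (n : ℕ) :
    (poissonMeasure r).real {n} ≤ poissonPeak r := by
  rcases eq_or_ne ⌊(r : ℝ)⌋₊ 0 with h0 | h0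
  · rw [poissonPeak, h0]; simp
  set m := ⌊(r : ℝ)⌋₊ with hm
  have hm1 : (1 : ℝ) ≤ m := by exact_mod_cast Nat.one_le_iff_ne_zero.2 h0
  have key (k : ℕ) (hk : m ≤ k) : (poissonMeasure r).real {k} ≤ poissonPeak r := by
    have hk' : (m : ℝ) ≤ k := by exact_mod_cast hk
    refine (poissonMeasure_real_le_inv_sqrt r (by omega)).trans ?_
    refine inv_anti₀ (Real.sqrt_pos.2 (by positivity)) (Real.sqrt_le_sqrt ?_)
    nlinarith [Real.pi_gt_three]
  rcases le_total m n with h | h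
  · exact key n h
  · exact (poissonMeasure_real_le_of_le h (Nat.floor_le r.2)).trans (key m le_rfl)

theorem tendsto_poissonPeak : Tendsto poissonPeak atTop (𝓝 0) := by
  refine tendsto_inv_atTop_zero.comp (Real.tendsto_sqrt_atTop.comp ?_)
  refine tendsto_atTop_add_const_right _ _ ?_
  exact (tendsto_natCast_atTop_atTop.comp tendsto_nat_floor_atTop).comp
    (NNReal.tendsto_coe_atTop.2 tendsto_id)

/-! ### Detection of altered rounds -/

namespace AliceStrategy

variable {H : Type u} [NormedAddCommGroup H] [InnerProductSpace ℂ H] {X : Type} [Fintype X]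
variable (S : AliceStrategy H X) (θ : ℝ)

/-- Unnormalised state of the memory when the first `n` qubits have passed their tests and qubit
`n` is found in the state orthogonal to the declared one. -/
noncomputable def failed (n : ℕ) (x : Fin (n + 1) → X) : H :=
  match S.ann (x (Fin.last n)) with
  | none => 0
  | some a => contract (perp θ a) (S.coin θ n x)

/-- Probability that qubit `n` is the first to fail its test, all declarations up to then being
valid. -/
noncomputable def failWeight (n : ℕ) : ℝ := ∑ x : Fin (n + 1) → X, ‖S.failed θ n x‖ ^ 2

theorem coin_of_none {n : ℕ} {x : Fin (n + 1) → X} (h : S.ann (x (Fin.last n)) = none) :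
    S.coin θ n x = 0 := by
  simp [coin, h]

theorem coin_of_some {n : ℕ} {x : Fin (n + 1) → X} {a : Bool}
    (h : S.ann (x (Fin.last n)) = some a) :
    S.coin θ n x = S.emit n (S.passed θ n (Fin.init x)) (x (Fin.last n)) := by
  simp [coin, h]

theorem passed_succ_of_none {n : ℕ} {x : Fin (n + 1) → X} (h : S.ann (x (Fin.last n)) = none) :
    S.passed θ (n + 1) x = 0 := by
  simp [passed, h]

theorem passed_succ_of_some {n : ℕ} {x : Fin (n + 1) → X} {a : Bool}
    (h : S.ann (x (Fin.last n)) = some a) :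
    S.passed θ (n + 1) x = contract (psi θ a) (S.coin θ n x) := by
  simp [passed, coin_of_some S θ h, h]

theorem failed_of_some {n : ℕ} {x : Fin (n + 1) → X} {a : Bool}
    (h : S.ann (x (Fin.last n)) = some a) :
    S.failed θ n x = contract (perp θ a) (S.coin θ n x) := by
  simp [failed, h]

theorem norm_passed_sq_add_norm_failed_sq (n : ℕ) (x : Fin (n + 1) → X) :
    ‖S.passed θ (n + 1) x‖ ^ 2 + ‖S.failed θ n x‖ ^ 2 = ‖S.coin θ n x‖ ^ 2 := by
  cases h : S.ann (x (Fin.last n)) with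
  | none => simp [passed_succ_of_none S θ h, coin_of_none S θ h, failed, h]
  | some a =>
    rw [passed_succ_of_some S θ h, failed_of_some S θ h, norm_contract_psi_sq_add]

theorem contract_pm_coin {n : ℕ} {x : Fin (n + 1) → X} {a : Bool}
    (h : S.ann (x (Fin.last n)) = some a) (b : Bool) :
    contract (pm b) (S.coin θ n x) = (overlap θ a b : ℂ) • S.passed θ (n + 1) x
      + (overlapPerp θ a b : ℂ) • S.failed θ n x := by
  rw [passed_succ_of_some S θ h, failed_of_some S θ h, ← contract_pm]

theorem sum_norm_emit_sq (i : ℕ) (v : H) : ∑ y, ‖S.emit i v y‖ ^ 2 = ‖v‖ ^ 2 := by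
  rw [← (S.step i).norm_map v, PiLp.norm_sq_eq_of_L2, Fintype.sum_prod_type]
  refine Finset.sum_congr rfl fun y _ => ?_
  rw [PiLp.norm_sq_eq_of_L2]; rfl

theorem sum_mul_norm_coin_sq_le (n : ℕ) {f : (Fin n → X) → ℝ} (hf : ∀ x, 0 ≤ f x) :
    ∑ x : Fin (n + 1) → X, f (Fin.init x) * ‖S.coin θ n x‖ ^ 2
      ≤ ∑ x, f x * ‖S.passed θ n x‖ ^ 2 := by
  calc _ ≤ ∑ x : Fin (n + 1) → X, f (Fin.init x)
          * ‖S.emit n (S.passed θ n (Fin.init x)) (x (Fin.last n))‖ ^ 2 := by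
        refine Finset.sum_le_sum fun x _ => mul_le_mul_of_nonneg_left ?_ (hf _)
        cases h : S.ann (x (Fin.last n)) with
        | none => simp [coin_of_none S θ h]
        | some a => rw [coin_of_some S θ h]
    _ = ∑ x, ∑ y, f x * ‖S.emit n (S.passed θ n x) y‖ ^ 2 :=
        sum_fin_succ_arrow n fun x y => f x * ‖S.emit n (S.passed θ n x) y‖ ^ 2
    _ = _ := by simp only [← Finset.mul_sum, sum_norm_emit_sq]

theorem failWeight_nonneg (n : ℕ) : 0 ≤ S.failWeight θ n :=
  Finset.sum_nonneg fun _ _ => by positivity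

theorem sum_norm_passed_sq_add_sum_failWeight_le (n : ℕ) :
    ∑ x, ‖S.passed θ n x‖ ^ 2 + ∑ i ∈ Finset.range n, S.failWeight θ i ≤ 1 := by
  induction n with
  | zero => simp [passed, S.norm_init]
  | succ n ih =>
    have h := S.sum_mul_norm_coin_sq_le θ n (f := fun _ => 1) fun _ => zero_le_one
    simp only [one_mul, ← norm_passed_sq_add_norm_failed_sq, Finset.sum_add_distrib] at h
    rw [Finset.sum_range_succ, failWeight]
    linarith

theorem sum_failWeight_le (n : ℕ) : ∑ i ∈ Finset.range n, S.failWeight θ i ≤ 1 := by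
  have := S.sum_norm_passed_sq_add_sum_failWeight_le θ n
  linarith [Finset.sum_nonneg fun x (_ : x ∈ Finset.univ) => sq_nonneg ‖S.passed θ n x‖]

theorem sum_norm_passed_sq_le (n : ℕ) : ∑ x, ‖S.passed θ n x‖ ^ 2 ≤ 1 := by
  have := S.sum_norm_passed_sq_add_sum_failWeight_le θ n
  linarith [Finset.sum_nonneg fun i (_ : i ∈ Finset.range n) => S.failWeight_nonneg θ i]

theorem integral_failWeight_le (μ : Measure ℕ) [IsProbabilityMeasure μ] {C : ℝ}
    (hC : ∀ n, μ.real {n} ≤ C) : ∫ n, S.failWeight θ n ∂μ ≤ C :=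
  integral_le_of_sum_range_le μ (S.failWeight_nonneg θ) (S.sum_failWeight_le θ) hC

theorem integrable_failWeight (μ : Measure ℕ) [IsProbabilityMeasure μ] :
    Integrable (S.failWeight θ) μ :=
  integrable_of_sum_range_le μ (S.failWeight_nonneg θ) (S.sum_failWeight_le θ)

variable {θ}

/-- An altered qubit fails its test with probability at least `δ ^ 2`. -/
theorem Altered.sq_mul_le {δ : ℝ} (hδ : 0 ≤ δ) {n : ℕ} {x : Fin (n + 1) → X}
    (h : S.Altered θ δ n x) : δ ^ 2 * ‖S.coin θ n x‖ ^ 2 ≤ ‖S.failed θ n x‖ ^ 2 := by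
  obtain ⟨a, ha, h⟩ := h
  have e : (if a then pMin θ else pMax θ) = overlap θ a false ^ 2 := by
    rw [overlap_sq, ideal]; cases a <;> simp
  rw [plusProb, e, contract_pm_coin S θ ha, ← norm_passed_sq_add_norm_failed_sq] at h
  rw [← norm_passed_sq_add_norm_failed_sq]
  exact sq_mul_le_of_le_abs_sub (overlap_sq_add_overlapPerp_sq θ a false) hδ _ _ h

open Classical in
theorem alteredCount_succ (δ : ℝ) (n : ℕ) (x : Fin (n + 1) → X) :
    S.alteredCount θ δ (n + 1) x
      = S.alteredCount θ δ n (Fin.init x) + if S.Altered θ δ n x then 1 else 0 := by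
  rw [alteredCount, alteredCount, Finset.card_filter, Finset.card_filter, Fin.sum_univ_castSucc]
  rfl

/-- The weight `(1 - δ²) ^ (k - j)`, where `j` is the number of altered rounds so far, is a
supermartingale. Truncated subtraction in the exponent avoids negative powers of `1 - δ²`, which
may vanish. -/
theorem sum_pow_sub_alteredCount_le {δ : ℝ} (hδ : δ ∈ Set.Ioc (0 : ℝ) 1) (k n : ℕ) :
    ∑ x, (1 - δ ^ 2) ^ (k - S.alteredCount θ δ n x) * ‖S.passed θ n x‖ ^ 2
      ≤ (1 - δ ^ 2) ^ k := by
  have h0 : 0 ≤ 1 - δ ^ 2 := by nlinarith [hδ.1, hδ.2]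
  have h1 : 1 - δ ^ 2 ≤ 1 := by nlinarith [hδ.1]
  induction n with
  | zero => simp [passed, S.norm_init, alteredCount]
  | succ n ih =>
    refine le_trans ?_ ((S.sum_mul_norm_coin_sq_le θ n fun x => pow_nonneg h0
      (k - S.alteredCount θ δ n x)).trans ih)
    refine Finset.sum_le_sum fun x _ => ?_
    have hs := S.norm_passed_sq_add_norm_failed_sq θ n x
    rw [alteredCount_succ]
    set j := S.alteredCount θ δ n (Fin.init x)
    split_ifs with ha
    · have hp : ‖S.passed θ (n + 1) x‖ ^ 2 ≤ (1 - δ ^ 2) * ‖S.coin θ n x‖ ^ 2 := by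
        have := Altered.sq_mul_le S hδ.1.le ha
        linarith
      refine (mul_le_mul_of_nonneg_left hp (pow_nonneg h0 _)).trans ?_
      rw [← mul_assoc, ← pow_succ]
      exact mul_le_mul_of_nonneg_right (pow_le_pow_of_le_one h0 h1 (by omega)) (sq_nonneg _)
    · rw [add_zero]
      refine mul_le_mul_of_nonneg_left ?_ (pow_nonneg h0 _)
      linarith [sq_nonneg ‖S.failed θ n x‖]

theorem undetectedAt_le_pow_ceil {δ : ℝ} (hδ : δ ∈ Set.Ioc (0 : ℝ) 1) (k : ℝ) (n : ℕ) :
    S.undetectedAt θ δ k n ≤ (1 - δ ^ 2) ^ ⌈k⌉₊ := by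
  have h0 : 0 ≤ 1 - δ ^ 2 := by nlinarith [hδ.1, hδ.2]
  refine le_trans (Finset.sum_le_sum fun x _ => ?_)
    (S.sum_pow_sub_alteredCount_le (θ := θ) hδ ⌈k⌉₊ n)
  split_ifs with h
  · rw [Nat.sub_eq_zero_of_le (Nat.ceil_le.2 h), pow_zero, one_mul]
  · positivity

theorem undetectedAt_le_pow {δ : ℝ} (hδ : δ ∈ Set.Ioc (0 : ℝ) 1) (n k : ℕ) :
    S.undetectedAt θ δ k n ≤ (1 - δ ^ 2) ^ k := by
  simpa using S.undetectedAt_le_pow_ceil (θ := θ) hδ k n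

theorem undetectedAt_le_rpow {δ : ℝ} (hδ : δ ∈ Set.Ioc (0 : ℝ) 1) {k : ℝ} (hk : 0 ≤ k) (n : ℕ) :
    S.undetectedAt θ δ k n ≤ (1 - δ ^ 2) ^ k := by
  have h0 : 0 ≤ 1 - δ ^ 2 := by nlinarith [hδ.1, hδ.2]
  have h1 : 1 - δ ^ 2 ≤ 1 := by nlinarith [hδ.1]
  refine (S.undetectedAt_le_pow_ceil hδ k n).trans ?_
  rw [← Real.rpow_natCast]
  exact Real.rpow_le_rpow_of_exponent_ge' h0 h1 hk (Nat.le_ceil k)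

variable (θ)

theorem undetectedAt_nonneg (δ k : ℝ) (n : ℕ) : 0 ≤ S.undetectedAt θ δ k n :=
  Finset.sum_nonneg fun _ _ => by positivity

theorem cheatAt_nonneg (δ k : ℝ) (n : ℕ) : 0 ≤ S.cheatAt θ δ k n :=
  Finset.sum_nonneg fun _ _ => by positivity

theorem cheatAt_le_undetectedAt (δ k : ℝ) (n : ℕ) :
    S.cheatAt θ δ k n ≤ S.undetectedAt θ δ k n := by
  classical
  have h := S.sum_mul_norm_coin_sq_le θ n
    (f := fun x => if k ≤ S.alteredCount θ δ n x then 1 else 0) fun x => by positivity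
  simp only [ite_mul, one_mul, zero_mul] at h
  refine le_trans (Finset.sum_le_sum fun x _ => ?_) (h.trans (le_of_eq ?_))
  · split_ifs with h1 h2 h2
    · exact le_rfl
    · exact absurd h1.2 h2
    · positivity
    · exact le_rfl
  · simp only [undetectedAt]

theorem cheatAt_le_failWeight {δ : ℝ} (hδ : 0 < δ) (k : ℝ) (n : ℕ) :
    S.cheatAt θ δ k n ≤ S.failWeight θ n / δ ^ 2 := by
  rw [le_div_iff₀ (by positivity), cheatAt, Finset.sum_mul]
  refine Finset.sum_le_sum fun x _ => ?_
  split_ifs with h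
  · rw [mul_comm]; exact Altered.sq_mul_le S hδ.le h.1
  · rw [zero_mul]; positivity

theorem cheatProb_le_mul_rpow {δ : ℝ} (hδ : δ ∈ Set.Ioc (0 : ℝ) 1) (μ : Measure ℕ)
    [IsProbabilityMeasure μ] {γ k : ℝ} (hk : 0 ≤ k) (h : S.coinAlteredProb θ μ δ k ≤ γ) :
    S.cheatProb θ μ δ k ≤ γ * (1 - δ ^ 2) ^ k := by
  have h0 : 0 ≤ (1 - δ ^ 2) ^ k := Real.rpow_nonneg (by nlinarith [hδ.1, hδ.2]) k
  have hr0 (n : ℕ) : 0 ≤ S.cheatAt θ δ k n / S.undetectedAt θ δ k n :=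
    div_nonneg (S.cheatAt_nonneg θ δ k n) (S.undetectedAt_nonneg θ δ k n)
  have hr1 (n : ℕ) : S.cheatAt θ δ k n / S.undetectedAt θ δ k n ≤ 1 :=
    div_le_one_of_le₀ (S.cheatAt_le_undetectedAt θ δ k n) (S.undetectedAt_nonneg θ δ k n)
  have hint : Integrable (fun n => S.cheatAt θ δ k n / S.undetectedAt θ δ k n) μ :=
    integrable_nat_of_abs_le μ (K := 1) fun n => by rw [abs_of_nonneg (hr0 n)]; exact hr1 n
  calc S.cheatProb θ μ δ k
      ≤ ∫ n, S.cheatAt θ δ k n / S.undetectedAt θ δ k n * (1 - δ ^ 2) ^ k ∂μ := by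
        refine integral_mono_of_nonneg (ae_of_all _ (S.cheatAt_nonneg θ δ k)) (hint.mul_const _)
          (ae_of_all _ fun n => ?_)
        rcases (S.undetectedAt_nonneg θ δ k n).eq_or_lt with hu | hu
        · have := S.cheatAt_le_undetectedAt θ δ k n
          rw [← hu] at this
          exact this.trans (mul_nonneg (hr0 n) h0)
        · calc S.cheatAt θ δ k n
              = S.cheatAt θ δ k n / S.undetectedAt θ δ k n * S.undetectedAt θ δ k n :=
                (div_mul_cancel₀ _ hu.ne').symm
            _ ≤ _ := mul_le_mul_of_nonneg_left (S.undetectedAt_le_rpow hδ hk n) (hr0 n)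
    _ = S.coinAlteredProb θ μ δ k * (1 - δ ^ 2) ^ k := integral_mul_const _ _
    _ ≤ _ := mul_le_mul_of_nonneg_right h h0

theorem cheatProb_le_div {δ : ℝ} (hδ : 0 < δ) (μ : Measure ℕ) [IsProbabilityMeasure μ] (k : ℝ)
    {C : ℝ} (hC : ∀ n, μ.real {n} ≤ C) : S.cheatProb θ μ δ k ≤ C / δ ^ 2 :=
  calc S.cheatProb θ μ δ k ≤ ∫ n, S.failWeight θ n / δ ^ 2 ∂μ :=
        integral_mono_of_nonneg (ae_of_all _ (S.cheatAt_nonneg θ δ k))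
          ((S.integrable_failWeight θ μ).div_const _)
          (ae_of_all _ (S.cheatAt_le_failWeight θ hδ k))
    _ = (∫ n, S.failWeight θ n ∂μ) / δ ^ 2 := integral_div _ _
    _ ≤ C / δ ^ 2 := div_le_div_of_nonneg_right (S.integral_failWeight_le θ μ hC) (by positivity)

end AliceStrategy

theorem tendsto_mul_rpow_mul_atTop {δ γ : ℝ} (hδ : δ ∈ Set.Ioc (0 : ℝ) 1) (hγ : 0 < γ) :
    Tendsto (fun n : ℕ => γ * (1 - δ ^ 2) ^ (γ * n)) atTop (𝓝 0) := by
  have h0 : 0 ≤ 1 - δ ^ 2 := by nlinarith [hδ.1, hδ.2]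
  have h1 : 1 - δ ^ 2 < 1 := by nlinarith [hδ.1]
  have h := (tendsto_pow_atTop_nhds_zero_of_lt_one (Real.rpow_nonneg h0 γ)
    (Real.rpow_lt_one h0 h1 hγ)).const_mul γ
  rw [mul_zero] at h
  refine h.congr fun n => ?_
  rw [Real.rpow_mul h0, Real.rpow_natCast]

/-! ### Posteriors and entropy -/

theorem posterior_mem_Icc {π ℓ : Bool → ℝ} (hπ : ∀ w, 0 ≤ π w) (hℓ : ∀ w, 0 ≤ ℓ w) (w : Bool) :
    posterior π ℓ w ∈ Set.Icc (0 : ℝ) 1 := by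
  have h (w) : 0 ≤ π w * ℓ w := mul_nonneg (hπ w) (hℓ w)
  have hs : 0 ≤ ∑ w', π w' * ℓ w' := Finset.sum_nonneg fun w _ => h w
  exact ⟨div_nonneg (h w) hs, div_le_one_of_le₀
    (Finset.single_le_sum (f := fun w' => π w' * ℓ w') (fun w _ => h w) (Finset.mem_univ w)) hs⟩

/-- Bayes' rule with the denominator cleared; it holds also where the total weight is `0`. -/
theorem sum_mul_posterior {π ℓ : Bool → ℝ} (hπ : ∀ w, 0 ≤ π w) (hℓ : ∀ w, 0 ≤ ℓ w) (w : Bool) :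
    (∑ w', π w' * ℓ w') * posterior π ℓ w = π w * ℓ w := by
  have h (w) : 0 ≤ π w * ℓ w := mul_nonneg (hπ w) (hℓ w)
  rcases eq_or_ne (∑ w', π w' * ℓ w') 0 with h0 | h0
  · rw [h0, zero_mul, (Finset.sum_eq_zero_iff_of_nonneg fun w _ => h w).1 h0 w (Finset.mem_univ w)]
  · exact mul_div_cancel₀ _ h0

/-- If the likelihoods `ℓ` are close to a multiple `q • i` of the likelihoods `i`, then an event
whose posterior is far from the one given by `i` has small probability. -/
theorem mul_sum_le_of_le_abs_posterior_sub {π ℓ i : Bool → ℝ} {q g : ℝ} (hπ : ∀ w, 0 ≤ π w)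
    (hℓ : ∀ w, 0 ≤ ℓ w) (hi : ∀ w, 0 ≤ i w) {w : Bool}
    (h : g ≤ |posterior π ℓ w - posterior π i w|) :
    g * ∑ w', π w' * ℓ w' ≤ 2 * ∑ w', π w' * |ℓ w' - i w' * q| := by
  have hPnn : 0 ≤ ∑ w', π w' * ℓ w' := Finset.sum_nonneg fun w _ => mul_nonneg (hπ w) (hℓ w)
  have hP := sum_mul_posterior hπ hℓ w
  have hQ := sum_mul_posterior hπ hi w
  obtain ⟨hI0, hI1⟩ := posterior_mem_Icc hπ hi w
  set P := ∑ w', π w' * ℓ w' with hPdef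
  set Q := ∑ w', π w' * i w' with hQdef
  set D := ∑ w', π w' * |ℓ w' - i w' * q| with hD
  have hDw : |π w * ℓ w - π w * i w * q| ≤ D := by
    have e : |π w * ℓ w - π w * i w * q| = π w * |ℓ w - i w * q| := by
      rw [mul_assoc, ← mul_sub, abs_mul, abs_of_nonneg (hπ w)]
    rw [e]
    exact Finset.single_le_sum (f := fun w' => π w' * |ℓ w' - i w' * q|)
      (fun w _ => mul_nonneg (hπ w) (abs_nonneg _)) (Finset.mem_univ w)
  have hPQ : |P - Q * q| ≤ D := by
    rw [hPdef, hQdef, Finset.sum_mul, ← Finset.sum_sub_distrib]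
    refine (Finset.abs_sum_le_sum_abs _ _).trans (Finset.sum_le_sum fun w _ => le_of_eq ?_)
    rw [mul_assoc, ← mul_sub, abs_mul, abs_of_nonneg (hπ w)]
  -- multiplying by the total weights makes the identity hold also where a posterior is `0 / 0`
  have e : P * (posterior π ℓ w - posterior π i w)
      = (π w * ℓ w - π w * i w * q) - posterior π i w * (P - Q * q) := by
    rw [← hP, ← hQ]; ring
  calc g * P ≤ |posterior π ℓ w - posterior π i w| * P := mul_le_mul_of_nonneg_right h hPnn
    _ = |P * (posterior π ℓ w - posterior π i w)| := by rw [abs_mul, abs_of_nonneg hPnn, mul_comm]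
    _ ≤ |π w * ℓ w - π w * i w * q| + |posterior π i w * (P - Q * q)| := by
        rw [e]; exact abs_sub _ _
    _ ≤ D + D := by
        refine add_le_add hDw ?_
        rw [abs_mul, abs_of_nonneg hI0]
        exact (mul_le_of_le_one_left (abs_nonneg _) hI1).trans hPQ
    _ = 2 * D := by ring

/-- The modulus of continuity of the binary entropy on `[0, 1]`. -/
noncomputable def entropyModulus (g : ℝ) : ℝ :=
  sSup {y | ∃ p ∈ Set.Icc (0 : ℝ) 1, ∃ p' ∈ Set.Icc (0 : ℝ) 1, |p - p'| ≤ g ∧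
    y = |Real.binEntropy p - Real.binEntropy p'|}

theorem entropyModulus_nonneg (g : ℝ) : 0 ≤ entropyModulus g :=
  Real.sSup_nonneg (by rintro _ ⟨p, _, p', _, _, rfl⟩; exact abs_nonneg _)

theorem abs_binEntropy_sub_le {g p p' : ℝ} (hp : p ∈ Set.Icc (0 : ℝ) 1)
    (hp' : p' ∈ Set.Icc (0 : ℝ) 1) (h : |p - p'| ≤ g) :
    |Real.binEntropy p - Real.binEntropy p'| ≤ entropyModulus g := by
  refine le_csSup ⟨Real.log 2, ?_⟩ ⟨p, hp, p', hp', h, rfl⟩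
  rintro _ ⟨a, ha, b, hb, _, rfl⟩
  have h1 := Real.binEntropy_nonneg ha.1 ha.2
  have h2 := Real.binEntropy_nonneg hb.1 hb.2
  have h3 := Real.binEntropy_le_log_two (p := a)
  have h4 := Real.binEntropy_le_log_two (p := b)
  rw [abs_le]; constructor <;> linarith

theorem tendsto_entropyModulus : Tendsto entropyModulus (𝓝 0) (𝓝 0) := by
  have huc := isCompact_Icc.uniformContinuousOn_of_continuous
    (Real.binEntropy_continuous.continuousOn (s := Set.Icc (0 : ℝ) 1))
  rw [Metric.uniformContinuousOn_iff_le] at huc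
  rw [Metric.tendsto_nhds]
  intro ε hε
  obtain ⟨d, hd, h⟩ := huc (ε / 2) (by positivity)
  filter_upwards [Iio_mem_nhds hd] with g hg
  rw [Real.dist_eq, sub_zero, abs_of_nonneg (entropyModulus_nonneg g)]
  refine lt_of_le_of_lt (Real.sSup_le ?_ (by positivity)) (half_lt_self hε)
  rintro _ ⟨p, hp, p', hp', hpp, rfl⟩
  exact h p hp p' hp' (by rw [Real.dist_eq]; exact hpp.trans hg.le)

/-- A bound, for two distributions of a bit whose probabilities differ by at most `g`, on both this
difference and the difference of their entropies in bits. -/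
noncomputable def infoModulus (g : ℝ) : ℝ := g + entropyModulus g / Real.log 2

theorem infoModulus_nonneg {g : ℝ} (hg : 0 ≤ g) : 0 ≤ infoModulus g :=
  add_nonneg hg (div_nonneg (entropyModulus_nonneg g) (Real.log_nonneg one_le_two))

theorem tendsto_infoModulus : Tendsto infoModulus (𝓝 0) (𝓝 0) := by
  have h := tendsto_id.add (tendsto_entropyModulus.div_const (Real.log 2))
  rw [zero_div, add_zero] at h
  exact h

theorem Informs.exists_le_abs_sub {g : ℝ} (hg : 0 ≤ g) {π π' : Bool → ℝ}
    (hπ : ∀ w, π w ∈ Set.Icc (0 : ℝ) 1) (hπ' : ∀ w, π' w ∈ Set.Icc (0 : ℝ) 1)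
    (h : Informs (infoModulus g) π π') : ∃ w, g ≤ |π' w - π w| := by
  by_contra! hc
  have hlog : 0 < Real.log 2 := Real.log_pos one_lt_two
  rcases h with h | ⟨w, h⟩
  · have hle : |π false - π' false| ≤ g := by rw [abs_sub_comm]; exact (hc false).le
    have hent := abs_binEntropy_sub_le (hπ false) (hπ' false) hle
    rw [bits, bits, ← sub_div, infoModulus] at h
    have := div_le_div_of_nonneg_right ((le_abs_self _).trans hent) hlog.le
    linarith
  · have := div_nonneg (entropyModulus_nonneg g) hlog.le
    rw [infoModulus] at h
    linarith [hc w]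

theorem not_informs_self {δ : ℝ} (hδ : 0 ≤ δ) (π : Bool → ℝ) : ¬ Informs δ π π := by
  rintro (h | ⟨w, h⟩)
  · rw [sub_self] at h; linarith
  · rw [sub_self, abs_zero] at h; linarith

theorem posterior_const {π : Bool → ℝ} (hπ1 : ∑ w, π w = 1) {k : ℝ} (hk : k ≠ 0) :
    posterior π (fun _ => k) = π := by
  funext w
  rw [posterior, ← Finset.sum_mul, hπ1, one_mul, mul_div_cancel_right₀ _ hk]

/-! ### Security against Alice -/

theorem Readout.sum_reApplyInnerSelf {H : Type u} [NormedAddCommGroup H] [InnerProductSpace ℂ H]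
    {X M : Type} [Fintype M] (R : Readout H X M) (n : ℕ) (x : Fin (n + 1) → X) (y : Option Bool)
    (v : H) : ∑ m, (R.eff n x y m).reApplyInnerSelf v = ‖v‖ ^ 2 := by
  rw [← reApplyInnerSelf_sum, R.sum_eq, reApplyInnerSelf_id]

namespace AliceStrategy

variable {H : Type u} [NormedAddCommGroup H] [InnerProductSpace ℂ H] {X : Type} [Fintype X]
variable (S : AliceStrategy H X) (θ : ℝ)

/-- Bound, up to the free parameter `t`, of the distance between the statistics of Bob's
measurement of qubit `n` and those of the declared state. -/
noncomputable def deviation (t : ℝ) (n : ℕ) (x : Fin (n + 1) → X) : ℝ :=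
  t * ‖S.passed θ (n + 1) x‖ ^ 2 + (1 + t⁻¹) * ‖S.failed θ n x‖ ^ 2

theorem deviation_nonneg {t : ℝ} (ht : 0 < t) (n : ℕ) (x : Fin (n + 1) → X) :
    0 ≤ S.deviation θ t n x := by
  rw [deviation]; positivity

theorem sum_deviation_le {t : ℝ} (ht : 0 < t) (n : ℕ) :
    ∑ x, S.deviation θ t n x ≤ t + (1 + t⁻¹) * S.failWeight θ n := by
  simp only [deviation, Finset.sum_add_distrib, ← Finset.mul_sum]
  exact add_le_add (mul_le_of_le_one_right ht.le (S.sum_norm_passed_sq_le θ (n + 1))) le_rfl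

theorem integrable_deviation (μ : Measure ℕ) [IsProbabilityMeasure μ] (t : ℝ) :
    Integrable (fun n => t + (1 + t⁻¹) * S.failWeight θ n) μ :=
  (integrable_const _).add ((S.integrable_failWeight θ μ).const_mul _)

/-- With `t = √C`, where `C` bounds the weights of `μ`, the mean deviation is at most
`C + 2 √C`. -/
theorem integral_deviation_le (μ : Measure ℕ) [IsProbabilityMeasure μ] {C : ℝ} (hC0 : 0 < C)
    (hC : ∀ n, μ.real {n} ≤ C) :
    ∫ n, (√C + (1 + (√C)⁻¹) * S.failWeight θ n) ∂μ ≤ C + 2 * √C := by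
  have hs : 0 < √C := Real.sqrt_pos.2 hC0
  rw [integral_add (integrable_const _) ((S.integrable_failWeight θ μ).const_mul _),
    integral_const_mul]
  have h := mul_le_mul_of_nonneg_left (S.integral_failWeight_le θ μ hC)
    (show 0 ≤ 1 + (√C)⁻¹ by positivity)
  have e : (1 + (√C)⁻¹) * C = C + √C := by
    have : (√C)⁻¹ * C = √C := by
      rw [inv_mul_eq_div, Real.div_sqrt]
    rw [add_mul, this, one_mul]
  simp only [integral_const, probReal_univ, smul_eq_mul, one_mul]
  linarith

theorem abs_reApplyInnerSelf_contract_pm_sub_le {T : H →L[ℂ] H} (hT : T.IsPositive) {t : ℝ}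
    (ht : 0 < t) {n : ℕ} {x : Fin (n + 1) → X} {a : Bool} (h : S.ann (x (Fin.last n)) = some a)
    (b : Bool) :
    |T.reApplyInnerSelf (contract (pm b) (S.coin θ n x))
        - ideal θ a b * T.reApplyInnerSelf (S.passed θ (n + 1) x)|
      ≤ t * T.reApplyInnerSelf (S.passed θ (n + 1) x)
        + (1 + t⁻¹) * T.reApplyInnerSelf (S.failed θ n x) := by
  rw [contract_pm_coin S θ h, ← overlap_sq]
  exact abs_reApplyInnerSelf_add_sub_le hT (overlap_sq_add_overlapPerp_sq θ a b) ht _ _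

theorem outcomeAt_nonneg (w c : Bool) (n : ℕ) : 0 ≤ S.outcomeAt θ w c n :=
  Finset.sum_nonneg fun _ _ => Finset.sum_nonneg fun _ _ => by positivity

/-- The outcome `c` requires the result `b' = a ⊕ c ⊕ w`, whose probability is the ideal one up to
the deviation. -/
theorem outcomeAt_le {t : ℝ} (ht : 0 < t) (w c : Bool) (n : ℕ) :
    S.outcomeAt θ w c n ≤ ideal θ w c + (t + (1 + t⁻¹) * S.failWeight θ n) := by
  have hx (x : Fin (n + 1) → X) : (∑ b' : Bool,
      if (S.ann (x (Fin.last n))).map (fun a => xor a (xor b' w)) = some c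
      then ‖contract (pm b') (S.coin θ n x)‖ ^ 2 else 0)
      ≤ ideal θ w c * ‖S.passed θ (n + 1) x‖ ^ 2 + S.deviation θ t n x := by
    cases h : S.ann (x (Fin.last n)) with
    | none =>
      simpa using add_nonneg (mul_nonneg (ideal_nonneg θ w c) (sq_nonneg _))
        (S.deviation_nonneg θ ht n x)
    | some a =>
      have hb := S.abs_reApplyInnerSelf_contract_pm_sub_le θ
        (ContinuousLinearMap.isPositive_id (𝕜 := ℂ) (E := H)) ht h (xor (xor a c) w)
      simp only [reApplyInnerSelf_id, ideal_xor] at hb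
      rw [← Bool.xor_assoc, Bool.xor_self, Bool.false_xor] at hb
      have e : (∑ b' : Bool, if (some a).map (fun a => xor a (xor b' w)) = some c
          then ‖contract (pm b') (S.coin θ n x)‖ ^ 2 else 0)
          = ‖contract (pm (xor (xor a c) w)) (S.coin θ n x)‖ ^ 2 := by
        rw [Finset.sum_eq_single (xor (xor a c) w)]
        · rw [if_pos]; cases a <;> cases c <;> cases w <;> rfl
        · intro b _ hb
          rw [if_neg]
          revert hb
          cases a <;> cases b <;> cases c <;> cases w <;> simp
        · simp
      rw [e, deviation]
      linarith [(abs_le.1 hb).2]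
  refine (Finset.sum_le_sum fun x _ => hx x).trans ?_
  rw [Finset.sum_add_distrib, ← Finset.mul_sum]
  exact add_le_add (mul_le_of_le_one_right (ideal_nonneg θ w c) (S.sum_norm_passed_sq_le θ (n + 1)))
    (S.sum_deviation_le θ ht n)

theorem outcomeProb_le (μ : Measure ℕ) [IsProbabilityMeasure μ] {C : ℝ} (hC0 : 0 < C)
    (hC : ∀ n, μ.real {n} ≤ C) (w c : Bool) :
    S.outcomeProb θ μ w c ≤ ideal θ w c + (C + 2 * √C) := by
  have hs : 0 < √C := Real.sqrt_pos.2 hC0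
  have hint := S.integrable_deviation θ μ (√C)
  calc S.outcomeProb θ μ w c
      ≤ ∫ n, (ideal θ w c + (√C + (1 + (√C)⁻¹) * S.failWeight θ n)) ∂μ :=
        integral_mono_of_nonneg (ae_of_all _ (S.outcomeAt_nonneg θ w c))
          ((integrable_const _).add hint) (ae_of_all _ (S.outcomeAt_le θ hs w c))
    _ = ideal θ w c + ∫ n, (√C + (1 + (√C)⁻¹) * S.failWeight θ n) ∂μ := by
        rw [integral_add (integrable_const _) hint]; simp
    _ ≤ _ := by linarith [S.integral_deviation_le θ μ hC0 hC]

variable {M : Type} [Fintype M] (R : Readout H X M)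

theorem acceptLik_nonneg (n : ℕ) (x : Fin (n + 1) → X) (b : Bool) (m : M) (w : Bool) :
    0 ≤ S.acceptLik θ R n x b m w :=
  reApplyInnerSelf_nonneg (R.positive _ _ _ _) _

open Classical in
/-- Contribution of the records `x`, the announcement `b` and the result `m` to the leak: in the
test-passing component alone the likelihoods are the ideal ones, up to a factor independent of
Bob's wish. -/
theorem leak_term_le {π : Bool → ℝ} (hπ : ∀ w, 0 ≤ π w) (hπ1 : ∑ w, π w = 1) {g t : ℝ}
    (hg : 0 < g) (ht : 0 < t) (n : ℕ) (x : Fin (n + 1) → X) (b : Bool) (m : M) :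
    (if ∃ a, S.ann (x (Fin.last n)) = some a ∧
        Informs (infoModulus g) (posterior π (fun w => ideal θ w (xor a b)))
          (posterior π (S.acceptLik θ R n x b m))
      then ∑ w : Bool, π w * S.acceptLik θ R n x b m w else 0)
      ≤ 2 / g * (t * (R.eff n x (some b) m).reApplyInnerSelf (S.passed θ (n + 1) x)
        + (1 + t⁻¹) * (R.eff n x (some b) m).reApplyInnerSelf (S.failed θ n x)) := by
  have hu := reApplyInnerSelf_nonneg (R.positive n x (some b) m) (S.passed θ (n + 1) x)
  have hv := reApplyInnerSelf_nonneg (R.positive n x (some b) m) (S.failed θ n x)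
  have hℓ := S.acceptLik_nonneg θ R n x b m
  split_ifs with h
  · obtain ⟨a, ha, hinf⟩ := h
    have hi (w : Bool) : 0 ≤ ideal θ w (xor a b) := ideal_nonneg θ w _
    obtain ⟨w, hw⟩ := hinf.exists_le_abs_sub hg.le (posterior_mem_Icc hπ hi)
      (posterior_mem_Icc hπ hℓ)
    have h1 := mul_sum_le_of_le_abs_posterior_sub hπ hℓ hi hw
      (q := (R.eff n x (some b) m).reApplyInnerSelf (S.passed θ (n + 1) x))
    set K := t * (R.eff n x (some b) m).reApplyInnerSelf (S.passed θ (n + 1) x)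
        + (1 + t⁻¹) * (R.eff n x (some b) m).reApplyInnerSelf (S.failed θ n x)
    have h2 : ∑ w', π w' * |S.acceptLik θ R n x b m w' - ideal θ w' (xor a b)
        * (R.eff n x (some b) m).reApplyInnerSelf (S.passed θ (n + 1) x)| ≤ ∑ w', π w' * K := by
      refine Finset.sum_le_sum fun w' _ => mul_le_mul_of_nonneg_left ?_ (hπ w')
      rw [← ideal_xor]
      exact S.abs_reApplyInnerSelf_contract_pm_sub_le θ (R.positive n x (some b) m) ht ha _
    rw [← Finset.sum_mul, hπ1, one_mul] at h2
    rw [div_mul_eq_mul_div, le_div_iff₀ hg, mul_comm]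
    linarith
  · positivity

theorem acceptedLeak_le (μ : Measure ℕ) [IsProbabilityMeasure μ] {C : ℝ} (hC0 : 0 < C)
    (hC : ∀ n, μ.real {n} ≤ C) {π : Bool → ℝ} (hπ : ∀ w, 0 ≤ π w) (hπ1 : ∑ w, π w = 1) {g : ℝ}
    (hg : 0 < g) : S.acceptedLeak θ R μ π (infoModulus g) ≤ 4 / g * (C + 2 * √C) := by
  classical
  have hs : 0 < √C := Real.sqrt_pos.2 hC0
  have hint := S.integrable_deviation θ μ (√C)
  have hsum (n : ℕ) (x : Fin (n + 1) → X) : ∑ b : Bool, ∑ m : M, 2 / g *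
      (√C * (R.eff n x (some b) m).reApplyInnerSelf (S.passed θ (n + 1) x)
        + (1 + (√C)⁻¹) * (R.eff n x (some b) m).reApplyInnerSelf (S.failed θ n x))
      = 4 / g * S.deviation θ (√C) n x := by
    simp only [← Finset.mul_sum, Finset.sum_add_distrib, Readout.sum_reApplyInnerSelf, deviation,
      Finset.sum_const, Finset.card_univ, Fintype.card_bool, nsmul_eq_mul]
    push_cast
    ring
  calc S.acceptedLeak θ R μ π (infoModulus g)
      ≤ ∫ n, 4 / g * (√C + (1 + (√C)⁻¹) * S.failWeight θ n) ∂μ := by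
        refine integral_mono_of_nonneg (ae_of_all _ fun n => ?_) (hint.const_mul _)
          (ae_of_all _ fun n => ?_)
        · refine Finset.sum_nonneg fun x _ => Finset.sum_nonneg fun b _ =>
            Finset.sum_nonneg fun m _ => ?_
          split_ifs
          · exact Finset.sum_nonneg fun w _ =>
              mul_nonneg (hπ w) (S.acceptLik_nonneg θ R n x b m w)
          · exact le_rfl
        · refine (Finset.sum_le_sum fun x _ => (Finset.sum_le_sum fun b _ =>
            Finset.sum_le_sum fun m _ => S.leak_term_le θ R hπ hπ1 hg hs n x b m).trans_eq
              (hsum n x)).trans ?_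
          rw [← Finset.mul_sum]
          exact mul_le_mul_of_nonneg_left (S.sum_deviation_le θ hs n) (by positivity)
    _ = 4 / g * ∫ n, (√C + (1 + (√C)⁻¹) * S.failWeight θ n) ∂μ := integral_const_mul _ _
    _ ≤ _ := mul_le_mul_of_nonneg_left (S.integral_deviation_le θ μ hC0 hC) (by positivity)

/-- Before Bob has announced a bit he has made no use of his wish, so the likelihood of what Alice
holds is the same for both wishes. -/
theorem abortedLeak_eq_zero (μ : Measure ℕ) {π : Bool → ℝ} (hπ1 : ∑ w, π w = 1) {δ : ℝ}
    (hδ : 0 ≤ δ) : S.abortedLeak θ R μ π δ = 0 := by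
  rw [abortedLeak]
  refine integral_eq_zero_of_ae (ae_of_all _ fun n => ?_)
  refine Finset.sum_eq_zero fun x _ => Finset.sum_eq_zero fun m _ => ?_
  split_ifs with h
  · -- where the likelihood vanishes the posterior is a junk value, but the weight is `0` as well
    rcases eq_or_ne (S.abortLik θ R n x m) 0 with h0 | h0
    · simp [h0]
    · rw [posterior_const hπ1 h0] at h
      exact absurd h (not_informs_self hδ π)
  · rfl

end AliceStrategy

/-- Bound of the mean deviation of Bob's statistics for a Poisson law. -/
noncomputable def poissonDeviation (r : ℝ≥0) : ℝ := poissonPeak r + 2 * √(poissonPeak r)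

theorem poissonDeviation_pos (r : ℝ≥0) : 0 < poissonDeviation r := by
  have := poissonPeak_pos r
  rw [poissonDeviation]; positivity

theorem tendsto_poissonDeviation : Tendsto poissonDeviation atTop (𝓝 0) := by
  have h := tendsto_poissonPeak.add (((Real.continuous_sqrt.tendsto 0).comp
    tendsto_poissonPeak).const_mul 2)
  rw [Real.sqrt_zero, mul_zero, add_zero] at h
  exact h

theorem tendsto_sqrt_poissonDeviation : Tendsto (fun r => √(poissonDeviation r)) atTop (𝓝 0) := by
  have h := (Real.continuous_sqrt.tendsto 0).comp tendsto_poissonDeviation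
  rwa [Real.sqrt_zero] at h

theorem acceptedLeak_poisson_lt {H : Type u} [NormedAddCommGroup H] [InnerProductSpace ℂ H]
    {X M : Type} [Fintype X] [Fintype M] (S : AliceStrategy H X) (θ : ℝ) (R : Readout H X M)
    (r : ℝ≥0) {π : Bool → ℝ} (hπ : ∀ w, 0 ≤ π w) (hπ1 : ∑ w, π w = 1) :
    S.acceptedLeak θ R (poissonMeasure r) π (infoModulus √(poissonDeviation r))
      < 5 * √(poissonDeviation r) := by
  have hg : 0 < √(poissonDeviation r) := Real.sqrt_pos.2 (poissonDeviation_pos r)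
  have h := S.acceptedLeak_le θ R (poissonMeasure r) (poissonPeak_pos r)
    (poissonMeasure_real_le_poissonPeak r) hπ hπ1 hg
  rw [← poissonDeviation, div_mul_eq_mul_div, mul_div_assoc, Real.div_sqrt] at h
  linarith

end VBCT1

theorem mainTheorem1 (θ : ℝ) (hθ : θ ∈ Set.Icc 0 (Real.pi / 2)) :
    -- the measurement in the basis `|±⟩` optimally distinguishes the two states
    ((∀ E : VBCT1.Qubit →L[ℂ] VBCT1.Qubit, E.IsPositive →
          (ContinuousLinearMap.id ℂ VBCT1.Qubit - E).IsPositive →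
          (E.reApplyInnerSelf (VBCT1.psi θ false)
            + (ContinuousLinearMap.id ℂ VBCT1.Qubit - E).reApplyInnerSelf (VBCT1.psi θ true)) / 2
            ≤ VBCT1.pMax θ) ∧
      (‖inner ℂ (VBCT1.pm false) (VBCT1.psi θ false)‖ ^ 2
        + ‖inner ℂ (VBCT1.pm true) (VBCT1.psi θ true)‖ ^ 2) / 2 = VBCT1.pMax θ) ∧
    -- both parties honest: the protocol never aborts and tosses the coin with the chosen bias
    (∀ (μ : Measure ℕ) [IsProbabilityMeasure μ] (w c : Bool),
      (VBCT1.honestAlice θ).outcomeProb θ μ w c = VBCT1.ideal θ w c) ∧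
    -- range of biases
    VBCT1.achievableBiases θ = Set.Icc (VBCT1.pMin θ) (VBCT1.pMax θ) ∧
    VBCT1.pMin θ + VBCT1.pMax θ = 1 ∧
    (∀ x y : ℝ, x < y →
      ((∃ t ∈ Set.Icc 0 (Real.pi / 2), VBCT1.achievableBiases t = Set.Icc x y)
        ↔ 0 ≤ x ∧ x + y = 1)) ∧
    -- perfect security against an arbitrary Bob
    (∀ (L : Type u) [NormedAddCommGroup L] [InnerProductSpace ℂ L] [CompleteSpace L]
        (B : VBCT1.BobStrategy L),
      (∀ c, Summable (B.outcomeAt θ c)) ∧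
      ∃ p ∈ Set.Icc (VBCT1.pMin θ) (VBCT1.pMax θ),
        B.outcomeProb θ false ≤ p ∧ B.outcomeProb θ true ≤ 1 - p) ∧
    -- honest Alice: her transcript can be simulated from the outcome and tells her nothing else
    (∀ (n : ℕ) (x : Fin (n + 1) → Bool) (b : Bool),
      (∀ w, VBCT1.honestLik θ n x b w
        = VBCT1.ideal θ w (xor (x (Fin.last n)) b) * (1 / 2) ^ (n + 1)) ∧
      ∀ (π : Bool → ℝ) (w : Bool), VBCT1.posterior π (VBCT1.honestLik θ n x b) w
        = VBCT1.posterior π (fun w' => VBCT1.ideal θ w' (xor (x (Fin.last n)) b)) w) ∧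
    -- an arbitrary Alice cannot shift the statistics of Bob's measurement undetected
    (∀ (H : Type u) [NormedAddCommGroup H] [InnerProductSpace ℂ H] [CompleteSpace H]
        (X : Type) [Fintype X] (S : VBCT1.AliceStrategy H X),
      ∀ δ ∈ Set.Ioc (0 : ℝ) 1,
        (∀ n k : ℕ, S.undetectedAt θ δ k n ≤ (1 - δ ^ 2) ^ k) ∧
        ∀ (μ : Measure ℕ) [IsProbabilityMeasure μ],
          (∀ (γ : ℝ) (n : ℕ), 0 ≤ γ → S.coinAlteredProb θ μ δ (γ * n) ≤ γ →
            S.cheatProb θ μ δ (γ * n) ≤ γ * (1 - δ ^ 2) ^ (γ * n)) ∧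
          ∀ C : ℝ, (∀ n, μ.real {n} ≤ C) → S.cheatProb θ μ δ 0 ≤ C / δ ^ 2) ∧
    (∀ δ ∈ Set.Ioc (0 : ℝ) 1, ∀ γ > (0 : ℝ),
      Tendsto (fun n : ℕ => γ * (1 - δ ^ 2) ^ (γ * n)) atTop (𝓝 0)) ∧
    (∀ δ ∈ Set.Ioc (0 : ℝ) 1, ∃ η : ℝ≥0 → ℝ, Tendsto η atTop (𝓝 0) ∧
      ∀ (r : ℝ≥0) (H : Type u) [NormedAddCommGroup H] [InnerProductSpace ℂ H] [CompleteSpace H]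
        (X : Type) [Fintype X] (S : VBCT1.AliceStrategy H X),
        S.cheatProb θ (poissonMeasure r) δ 0 ≤ η r) ∧
    -- security of the coin toss against an arbitrary Alice, as the Poisson mean tends to infinity
    ∃ ε δ ζ : ℝ≥0 → ℝ, Tendsto ε atTop (𝓝 0) ∧ Tendsto δ atTop (𝓝 0) ∧ Tendsto ζ atTop (𝓝 0) ∧
      ∀ (r : ℝ≥0) (H : Type u) [NormedAddCommGroup H] [InnerProductSpace ℂ H] [CompleteSpace H]
        (X : Type) [Fintype X] (S : VBCT1.AliceStrategy H X),
        (∀ w c, S.outcomeProb θ (poissonMeasure r) w c ≤ VBCT1.ideal θ w c + ε r) ∧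
        ∀ (M : Type) [Fintype M] (R : VBCT1.Readout H X M) (π : Bool → ℝ),
          (∀ w, 0 ≤ π w) → ∑ w, π w = 1 →
          S.acceptedLeak θ R (poissonMeasure r) π (δ r) < ζ r ∧
          S.acceptedLeak θ R (poissonMeasure r) π (δ r)
            + S.abortedLeak θ R (poissonMeasure r) π (δ r) < ζ r := by
  have hs : 0 ≤ Real.sin θ :=
    Real.sin_nonneg_of_nonneg_of_le_pi hθ.1 (by linarith [hθ.2, Real.pi_pos])
  refine ⟨⟨fun E => VBCT1.guessing_le_pMax hs, VBCT1.guessing_pm θ⟩, fun μ _ w c => ?_,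
    VBCT1.achievableBiases_eq hs, VBCT1.pMin_add_pMax θ,
    fun x y => VBCT1.exists_achievableBiases_eq_iff,
    fun L _ _ _ B => ⟨B.summable_outcomeAt hs, B.exists_bias hs⟩,
    fun n x b => ⟨VBCT1.honestLik_eq θ n x b, fun π w => ?_⟩,
    fun H _ _ _ X _ S δ hδ => ⟨S.undetectedAt_le_pow hδ, fun μ _ =>
      ⟨fun γ n hγ h => S.cheatProb_le_mul_rpow θ hδ μ (by positivity) h,
        fun C hC => S.cheatProb_le_div θ hδ.1 μ 0 hC⟩⟩,
    fun δ hδ γ hγ => VBCT1.tendsto_mul_rpow_mul_atTop hδ hγ,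
    fun δ hδ => ⟨fun r => VBCT1.poissonPeak r / δ ^ 2, ?_, fun r H _ _ _ X _ S =>
      S.cheatProb_le_div θ hδ.1 _ 0 (VBCT1.poissonMeasure_real_le_poissonPeak r)⟩,
    VBCT1.poissonDeviation, fun r => VBCT1.infoModulus √(VBCT1.poissonDeviation r),
    fun r => 5 * √(VBCT1.poissonDeviation r), VBCT1.tendsto_poissonDeviation,
    VBCT1.tendsto_infoModulus.comp VBCT1.tendsto_sqrt_poissonDeviation, ?_,
    fun r H _ _ _ X _ S => ⟨S.outcomeProb_le θ _ (VBCT1.poissonPeak_pos r)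
      (VBCT1.poissonMeasure_real_le_poissonPeak r), fun M _ R π hπ hπ1 => ?_⟩⟩
  · simp only [VBCT1.AliceStrategy.outcomeProb, VBCT1.honestAlice_outcomeAt, integral_const,
      probReal_univ, one_smul]
  · rw [funext fun w' => VBCT1.honestLik_eq θ n x b w',
      VBCT1.posterior_mul_const π _ (by positivity)]
  · simpa using VBCT1.tendsto_poissonPeak.div_const (δ ^ 2)
  · simpa using VBCT1.tendsto_sqrt_poissonDeviation.const_mul 5
  · have h := VBCT1.acceptedLeak_poisson_lt S θ R r hπ hπ1
    rw [S.abortedLeak_eq_zero θ R _ hπ1 (VBCT1.infoModulus_nonneg (Real.sqrt_nonneg _)), add_zero]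
    exact ⟨h, h⟩
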